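/- Let $p>3$ be a prime and let $X$ be a connected finite simple undirected graph with $6p$ vertices. Suppose that $X$ is genuinely imprimitive with blocks of size $p$, that is: there are a subgroup $G$ of the automorphism group $\mathrm{Aut}(X)$ acting transitively on the vertex set $V(X)$ and a normal subgroup $N$ of $G$ such that the orbits of $N$ on $V(X)$ form an imprimitivity block system of $G$ (a partition of $V(X)$ whose parts are permuted by the elements of $G$, different from $\{V(X)\}$ and from the partition into singletons) and every orbit of $N$ has exactly $p$ elements. Then $X$ has a Hamilton cycle, that is, a cycle passing through every vertex of $X$ exactly once. -/

import Mathlib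

open scoped Pointwise

/-- The partition of `V` into the orbits of a group `H` acting on `V`. -/
def orbitPartition (H V : Type*) [Group H] [MulAction H V] : Set (Set V) :=
  Set.range fun v : V => MulAction.orbit H v

/-- A partition `ℬ` of `V` is `H`-invariant if the elements of `H` permute its parts setwise. -/
def IsInvariantPartition (H : Type*) {V : Type*} [Group H] [MulAction H V]
    (ℬ : Set (Set V)) : Prop :=
  Setoid.IsPartition ℬ ∧ ∀ h : H, ∀ B ∈ ℬ, h • B ∈ ℬ

/-- An imprimitivity block system: an invariant partition which is neither `{V}` nor the
partition into singletons. -/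
def IsImprimitivityBlockSystem (H : Type*) {V : Type*} [Group H] [MulAction H V]
    (ℬ : Set (Set V)) : Prop :=
  IsInvariantPartition H ℬ ∧ ℬ ≠ {Set.univ} ∧ ℬ ≠ Set.range fun v : V => ({v} : Set V)

namespace SimpleGraph

/-- `G` is a transitive group of automorphisms of `X` (acting on vertices by evaluation), `N` is a normal subgroup of `G`, and the
orbits of `N` form an imprimitivity block system of `G`. -/
structure IsGenuinelyImprimitiveVia {V : Type*} (X : SimpleGraph V)
    (G : Subgroup (X ≃g X)) (N : Subgroup G) : Prop where
  transitive : MulAction.IsPretransitive G V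
  normal : N.Normal
  blockSystem : IsImprimitivityBlockSystem G (orbitPartition N V)

/-- `X` is genuinely imprimitive: some transitive group `G` of automorphisms of `X` has an
imprimitivity block system that consists of the orbits of a normal subgroup of `G`. -/
def IsGenuinelyImprimitive {V : Type*} (X : SimpleGraph V) : Prop :=
  ∃ (G : Subgroup (X ≃g X)) (N : Subgroup G), X.IsGenuinelyImprimitiveVia G N

/-- `X` is genuinely imprimitive with blocks of size `k`: some transitive group `G` of
automorphisms of `X` has an imprimitivity block system that consists of the orbits of a normal
subgroup of `G` and all of whose blocks have `k` elements. -/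
def IsGenuinelyImprimitiveWithBlockSize {V : Type*} (X : SimpleGraph V) (k : ℕ) : Prop :=
  ∃ (G : Subgroup (X ≃g X)) (N : Subgroup G),
    X.IsGenuinelyImprimitiveVia G N ∧ ∀ B ∈ orbitPartition N V, B.ncard = k

theorem IsGenuinelyImprimitiveWithBlockSize.isGenuinelyImprimitive {V : Type*}
    {X : SimpleGraph V} {k : ℕ} (h : X.IsGenuinelyImprimitiveWithBlockSize k) :
    X.IsGenuinelyImprimitive :=
  let ⟨G, N, hGN, _⟩ := h
  ⟨G, N, hGN⟩

end SimpleGraph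

/-! The quotient graph on the six blocks is connected and regular, so it is the hexagon, the prism,
`K₃,₃`, the octahedron or `K₆`. Each edge of these lies on a Hamilton cycle
(`exists_hamiltonian_six_cycle`). By Cauchy, `N` contains an element `α` of order `p`.

If `α` fixes a vertex, connectedness gives an edge between a moved and a fixed vertex, and the two
blocks of that edge are joined completely. A Hamilton cycle of blocks through this pair, with
perfect matchings along its other edges, lifts to `X`, because the complete pair permits any closing
shift (`hamiltonian_of_complete_blocks`).

If `α` fixes no vertex, its orbits are the blocks and `X` is described by voltages in `ZMod p`
(`exists_isCyclicSystem`). Suppose first that some edge lies inside a block. By transitivity every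
block then carries a `p`-cycle with some step, and these cycles are glued along a Hamilton cycle of
blocks. One method serves when two consecutive steps agree up to sign (`hamiltonian_of_step_eq`),
another when none do (`hamiltonian_of_steps_ne`).

Without inner edges, a Hamilton cycle of blocks with nonzero total voltage lifts to a Hamilton
cycle, since `p` is prime (`hamiltonian_of_voltage`). If all totals vanish, linear algebra over
`ZMod p`, where 2 and 3 are invertible, makes the voltages trivial up to a potential, against
connectedness. The one exception is the prism with opposite voltages on its triangles, which has an
explicit Hamilton cycle (`voltage_eq_zero_or_prism`, `hamiltonian_of_prism`). -/

namespace SimpleGraph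

/-! ### Paths with a prescribed vertex set -/

variable {V : Type*} {X : SimpleGraph V}

/-- There is a path from `u` to `v` whose set of vertices is exactly `S`. -/
def PathOn (X : SimpleGraph V) (S : Set V) (u v : V) : Prop :=
  ∃ w : X.Walk u v, w.IsPath ∧ {x | x ∈ w.support} = S

theorem PathOn.single (v : V) : X.PathOn {v} v v :=
  ⟨Walk.nil, by simp, by ext; simp⟩

theorem PathOn.symm {S : Set V} {u v : V} (h : X.PathOn S u v) : X.PathOn S v u := by
  obtain ⟨w, hw, rfl⟩ := h
  exact ⟨w.reverse, hw.reverse, by ext; simp⟩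

theorem PathOn.append {S T : Set V} {u v v' w : V} (h : X.PathOn S u v) (hv : X.Adj v v')
    (h' : X.PathOn T v' w) (hST : Disjoint S T) : X.PathOn (S ∪ T) u w := by
  obtain ⟨a, ha, rfl⟩ := h
  obtain ⟨b, hb, rfl⟩ := h'
  refine ⟨a.append (Walk.cons hv b), ?_, ?_⟩
  · rw [Walk.isPath_def, Walk.support_append, Walk.support_cons, List.tail_cons,
      List.nodup_append']
    refine ⟨ha.support_nodup, hb.support_nodup, ?_⟩
    intro x hx hy
    exact Set.disjoint_left.mp hST hx hy
  · ext x
    simp [Walk.support_append]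

theorem PathOn.congr {S T : Set V} {u v u' v' : V} (h : X.PathOn S u v) (hST : S = T)
    (hu : u = u') (hv : v = v') : X.PathOn T u' v' := by
  subst hST hu hv; exact h

/-- Paths on disjoint sets, each linked to the next one, concatenate. -/
theorem PathOn.concat (C : ℕ → Set V) (a z : ℕ → V) (n : ℕ)
    (hC : ∀ i ≤ n, X.PathOn (C i) (a i) (z i))
    (hdisj : ∀ i ≤ n, ∀ j < i, Disjoint (C j) (C i))
    (hadj : ∀ i < n, X.Adj (z i) (a (i + 1))) :
    X.PathOn (⋃ i ≤ n, C i) (a 0) (z n) := by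
  induction n with
  | zero => exact (hC 0 le_rfl).congr (by simp) rfl rfl
  | succ n ih =>
    have h1 := ih (fun i hi => hC i (by omega)) (fun i hi => hdisj i (by omega))
      (fun i hi => hadj i (by omega))
    refine (h1.append (hadj n (by omega)) (hC (n + 1) le_rfl) ?_).congr ?_ rfl rfl
    · simp only [Set.disjoint_iUnion_left]
      intro i hi
      exact hdisj (n + 1) le_rfl i (by omega)
    · rw [Set.biUnion_le_succ]

/-- A path through all vertices with adjacent ends closes up to a Hamilton cycle. -/
theorem PathOn.exists_isHamiltonianCycle [Fintype V] [DecidableEq V] {S : Set V} {u v : V}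
    (h : X.PathOn S u v) (hS : S = Set.univ) (hvu : X.Adj v u) (hcard : 2 < Fintype.card V) :
    ∃ (v : V) (C : X.Walk v v), C.IsHamiltonianCycle := by
  obtain ⟨w, hw, hw'⟩ := h
  have hmem : ∀ x, x ∈ w.support := by
    intro x
    have : x ∈ {x | x ∈ w.support} := by rw [hw', hS]; trivial
    exact this
  have hham := hw.isHamiltonian_of_mem hmem
  have hlen := hham.length_eq
  refine ⟨v, Walk.cons hvu w, ?_⟩
  rw [Walk.isHamiltonianCycle_iff_isCycle_and_length_eq, Walk.cons_isCycle_iff]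
  refine ⟨⟨hw, ?_⟩, by rw [Walk.length_cons]; omega⟩
  intro he
  have h1 := hw.length_eq_one_of_mem_edges (by rwa [Sym2.eq_swap] at he)
  omega

/-- The set `U` splits into two parts that carry a path from `a` to `a'` and one from `c`
to `c'`. -/
def TwoPathsOn (X : SimpleGraph V) (U : Set V) (a a' c c' : V) : Prop :=
  ∃ S T : Set V, Disjoint S T ∧ S ∪ T = U ∧ X.PathOn S a a' ∧ X.PathOn T c c'

theorem TwoPathsOn.symm_right {U : Set V} {a a' c c' : V} (h : X.TwoPathsOn U a a' c c') :
    X.TwoPathsOn U a a' c' c := by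
  obtain ⟨S, T, hd, hU, hS, hT⟩ := h
  exact ⟨S, T, hd, hU, hS, hT.symm⟩

/-- Four disjoint paths attached to the four ends of a pair of paths. -/
theorem TwoPathsOn.extend {U R I₁ I₂ I₃ I₄ : Set V} {a₁ a₂ a₃ a₄ b₁ b₂ b₃ b₄ c₁ c₂ c₃ c₄ : V}
    (h : X.TwoPathsOn U a₁ a₂ a₃ a₄) (h₁ : X.PathOn I₁ c₁ b₁) (h₂ : X.PathOn I₂ c₂ b₂)
    (h₃ : X.PathOn I₃ c₃ b₃) (h₄ : X.PathOn I₄ c₄ b₄)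
    (e₁ : X.Adj b₁ a₁) (e₂ : X.Adj b₂ a₂) (e₃ : X.Adj b₃ a₃) (e₄ : X.Adj b₄ a₄)
    (hR : I₁ ∪ I₂ ∪ I₃ ∪ I₄ = R) (hUR : Disjoint U R) (h12 : Disjoint I₁ I₂)
    (h13 : Disjoint I₁ I₃) (h14 : Disjoint I₁ I₄) (h23 : Disjoint I₂ I₃) (h24 : Disjoint I₂ I₄)
    (h34 : Disjoint I₃ I₄) :
    X.TwoPathsOn (U ∪ R) c₁ c₂ c₃ c₄ := by
  obtain ⟨S, T, hd, rfl, hS, hT⟩ := h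
  subst hR
  simp only [Set.disjoint_left, Set.mem_union] at hd hUR h12 h13 h14 h23 h24 h34
  refine ⟨I₁ ∪ S ∪ I₂, I₃ ∪ T ∪ I₄, ?_, ?_, (h₁.append e₁ hS ?_).append e₂.symm h₂.symm ?_,
    (h₃.append e₃ hT ?_).append e₄.symm h₄.symm ?_⟩
  · simp only [Set.disjoint_left, Set.mem_union]; grind
  · ext x; simp only [Set.mem_union]; tauto
  all_goals simp only [Set.disjoint_left, Set.mem_union]; grind

end SimpleGraph

/-! ### Multiples of a nonzero residue modulo a prime -/

theorem ZMod.exists_nat_mul_eq {p : ℕ} [Fact p.Prime] {b c : ZMod p} (hc : c ≠ 0) :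
    ∃ m : ℕ, m < p ∧ (m : ZMod p) * c = b :=
  ⟨(b / c).val, ZMod.val_lt _, by rw [ZMod.natCast_zmod_val]; field_simp⟩

/-- Excluding `0` and `±c` says that, in the `p`-cycle with step `c`, the edges starting at `0` and
at `b` share no vertex. -/
theorem ZMod.exists_nat_mul_eq_of_ne {p : ℕ} [Fact p.Prime] {b c : ZMod p} (hc : c ≠ 0)
    (h0 : b ≠ 0) (h1 : b ≠ c) (h2 : b ≠ -c) :
    ∃ m : ℕ, 2 ≤ m ∧ m + 2 ≤ p ∧ (m : ZMod p) * c = b := by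
  obtain ⟨m, hm, rfl⟩ := ZMod.exists_nat_mul_eq (b := b) hc
  refine ⟨m, ?_, ?_, rfl⟩
  · by_contra h
    interval_cases m <;> simp_all
  · by_contra h
    have : p = m + 1 := by omega
    apply h2
    have h3 : ((m + 1 : ℕ) : ZMod p) = 0 := by rw [← this]; exact ZMod.natCast_self p
    push_cast at h3
    linear_combination c * h3

theorem ZMod.natCast_mul_inj {p : ℕ} [Fact p.Prime] {c : ZMod p} (hc : c ≠ 0) {i j : ℕ}
    (hij : (i : ZMod p) * c = j * c) (h1 : i < j + p) (h2 : j < i + p) : i = j := by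
  have h := mul_right_cancel₀ hc hij
  rw [ZMod.natCast_eq_natCast_iff] at h
  rcases le_total i j with hle | hle
  · have := (Nat.modEq_iff_dvd' hle).mp h
    have := Nat.eq_zero_of_dvd_of_lt this (by omega)
    omega
  · have := (Nat.modEq_iff_dvd' hle).mp h.symm
    have := Nat.eq_zero_of_dvd_of_lt this (by omega)
    omega

/-! ### Cutting a `p`-cycle into arcs -/

namespace SimpleGraph

variable {V : Type*} {X : SimpleGraph V} {p : ℕ}

/-- The vertices `ρ (y + i * c)` with `a ≤ i ≤ b`. -/
def rowArc (ρ : ZMod p → V) (y c : ZMod p) (a b : ℕ) : Set V :=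
  {v | ∃ i : ℕ, a ≤ i ∧ i ≤ b ∧ v = ρ (y + i * c)}

theorem rowArc_subset (ρ : ZMod p → V) (y c : ZMod p) (a b : ℕ) :
    rowArc ρ y c a b ⊆ Set.range ρ := by
  rintro _ ⟨i, -, -, rfl⟩; exact ⟨_, rfl⟩

theorem rowArc_union (ρ : ZMod p → V) (y c : ZMod p) {a b d : ℕ} (hab : a ≤ b + 1)
    (hbd : b ≤ d) : rowArc ρ y c a b ∪ rowArc ρ y c (b + 1) d = rowArc ρ y c a d := by
  ext v
  constructor
  · rintro (⟨i, h1, h2, rfl⟩ | ⟨i, h1, h2, rfl⟩)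
    · exact ⟨i, h1, by omega, rfl⟩
    · exact ⟨i, by omega, h2, rfl⟩
  · rintro ⟨i, h1, h2, rfl⟩
    rcases le_or_gt i b with h | h
    · exact Or.inl ⟨i, h1, h, rfl⟩
    · exact Or.inr ⟨i, h, h2, rfl⟩

theorem rowArc_eq_range [Fact p.Prime] (ρ : ZMod p → V) (y : ZMod p) {c : ZMod p} (hc : c ≠ 0)
    {a b : ℕ} (hab : b + 1 = a + p) : rowArc ρ y c a b = Set.range ρ := by
  refine (rowArc_subset ρ y c a b).antisymm ?_
  rintro _ ⟨x, rfl⟩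
  obtain ⟨m, hm, hx⟩ := ZMod.exists_nat_mul_eq (b := x - y - (a : ZMod p) * c) hc
  refine ⟨a + m, by omega, by omega, ?_⟩
  congr 1
  push_cast
  linear_combination -hx

theorem rowArc_disjoint [Fact p.Prime] {ρ : ZMod p → V} (hρ : Function.Injective ρ) (y : ZMod p)
    {c : ZMod p} (hc : c ≠ 0) {a b a' b' : ℕ} (h1 : b < a') (h2 : b' < a + p) :
    Disjoint (rowArc ρ y c a b) (rowArc ρ y c a' b') := by
  rw [Set.disjoint_left]
  rintro _ ⟨i, hi, hi', rfl⟩ ⟨j, hj, hj', h⟩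
  have h3 := add_left_cancel (hρ h)
  have := ZMod.natCast_mul_inj hc h3 (by omega) (by omega)
  omega

theorem rowArc_pathOn [Fact p.Prime] {ρ : ZMod p → V} (hρ : Function.Injective ρ) {y c : ZMod p}
    (hc : c ≠ 0) (hadj : ∀ x, X.Adj (ρ x) (ρ (x + c))) {a b : ℕ} (hab : a ≤ b) (hb : b < a + p) :
    X.PathOn (rowArc ρ y c a b) (ρ (y + a * c)) (ρ (y + b * c)) := by
  have single (k : ℕ) : X.PathOn (rowArc ρ y c k k) (ρ (y + k * c)) (ρ (y + k * c)) := by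
    refine (PathOn.single _).congr ?_ rfl rfl
    ext v
    constructor
    · rintro rfl; exact ⟨k, le_rfl, le_rfl, rfl⟩
    · rintro ⟨i, h1, h2, rfl⟩
      obtain rfl : i = k := by omega
      rfl
  induction b, hab using Nat.le_induction with
  | base => exact single a
  | succ b hab ih =>
    have h := (ih (by omega)).append (v' := ρ (y + (b + 1 : ℕ) * c)) ?_ (single (b + 1))
      (rowArc_disjoint hρ y hc (by omega) (by omega))
    · rwa [rowArc_union ρ y c (by omega) (by omega)] at h
    · have := hadj (y + b * c)
      convert this using 2
      push_cast; ring

/-- A closed row is a path between any two vertices at distance one step. -/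
theorem row_pathOn [Fact p.Prime] {ρ : ZMod p → V} (hρ : Function.Injective ρ) {c : ZMod p}
    (hc : c ≠ 0) (hadj : ∀ x, X.Adj (ρ x) (ρ (x + c))) (y : ZMod p) :
    X.PathOn (Set.range ρ) (ρ (y + c)) (ρ y) := by
  have hp : 0 < p := (Fact.out : p.Prime).pos
  have := rowArc_pathOn (y := y) hρ hc hadj (a := 1) (b := p) (by omega) (by omega)
  rw [rowArc_eq_range ρ y hc (by omega)] at this
  simpa using this

/-- Two vertex-disjoint paths that cover a closed row. -/
theorem row_split [Fact p.Prime] {ρ : ZMod p → V} (hρ : Function.Injective ρ) {b c : ZMod p}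
    (hb : b ≠ 0) (hadj : ∀ x, X.Adj (ρ x) (ρ (x + b))) (hc : c ≠ 0) :
    ∃ y, X.TwoPathsOn (Set.range ρ) (ρ (y + b)) (ρ (y + c)) (ρ (y + c + b)) (ρ y) := by
  obtain ⟨m, hm, rfl⟩ := ZMod.exists_nat_mul_eq (b := c) hb
  have hm0 : m ≠ 0 := by rintro rfl; simp at hc
  -- The position on the cycle is free, hence `y = 0`. The arcs consist of the multiples `1, …, m`
  -- and `m + 1, …, p` of `b`.
  refine ⟨0, rowArc ρ 0 b 1 m, rowArc ρ 0 b (m + 1) p, rowArc_disjoint hρ _ hb ?_ ?_, ?_, ?_, ?_⟩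
  · omega
  · omega
  · rw [rowArc_union _ _ _ (by omega) (by omega), rowArc_eq_range _ _ hb (by omega)]
  · simpa using rowArc_pathOn (y := 0) hρ hb hadj (a := 1) (b := m) (by omega) (by omega)
  · have := rowArc_pathOn (y := 0) hρ hb hadj (a := m + 1) (b := p) (by omega) (by omega)
    simpa [add_mul] using this

/-- A closed row with step `c`, cut at the edges that start at `y` and `y + b`, is cut once more at
two edges whose distance `j` is prescribed. -/
theorem row_split_four [Fact p.Prime] {ρ : ZMod p → V} (hρ : Function.Injective ρ) {b c j : ZMod p}
    (hc : c ≠ 0) (hadj : ∀ x, X.Adj (ρ x) (ρ (x + c))) (y : ZMod p)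
    (hb : b ≠ 0) (hbc : b ≠ c) (hbc' : b ≠ -c) (hj : j ≠ 0) (hjc : j ≠ c) (hjc' : j ≠ -c) :
    ∃ (y' : ZMod p) (I₁ I₂ I₃ I₄ : Set V),
      X.PathOn I₁ (ρ y') (ρ (y + c)) ∧ X.PathOn I₂ (ρ (y' + c)) (ρ (y + b)) ∧
      X.PathOn I₃ (ρ (y' + j)) (ρ (y + c + b)) ∧ X.PathOn I₄ (ρ (y' + j + c)) (ρ y) ∧
      I₁ ∪ I₂ ∪ I₃ ∪ I₄ = Set.range ρ ∧ Disjoint I₁ I₂ ∧ Disjoint I₁ I₃ ∧ Disjoint I₁ I₄ ∧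
      Disjoint I₂ I₃ ∧ Disjoint I₂ I₄ ∧ Disjoint I₃ I₄ := by
  obtain ⟨m, hm, hm', rfl⟩ := ZMod.exists_nat_mul_eq_of_ne hc hb hbc hbc'
  obtain ⟨q, hq, hq', rfl⟩ := ZMod.exists_nat_mul_eq_of_ne hc hj hjc hjc'
  -- In steps of `c` counted from `y`, the old cuts leave the arcs `1, …, m` and `m + 1, …, p`. The
  -- new cut after `i` lies inside the first arc and the one after `i + q` inside the second, so
  -- each of the four pieces has one old and one new end.
  obtain ⟨i, hi1, hi2, hi3, hi4⟩ : ∃ i, 1 ≤ i ∧ i < m ∧ m + 1 ≤ i + q ∧ i + q + 1 ≤ p := by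
    rcases le_or_gt m q with h | h
    · exact ⟨1, by omega⟩
    · exact ⟨m + 1 - q, by omega⟩
  have path {a b : ℕ} (hab : a ≤ b) (hb : b < a + p) := rowArc_pathOn (y := y) hρ hc hadj hab hb
  refine ⟨y + i * c, rowArc ρ y c 1 i, rowArc ρ y c (i + 1) m, rowArc ρ y c (m + 1) (i + q),
    rowArc ρ y c (i + q + 1) p, (path ?_ ?_).symm.congr rfl ?_ ?_, (path ?_ ?_).congr rfl ?_ ?_,
    (path ?_ ?_).symm.congr rfl ?_ ?_, (path ?_ ?_).congr rfl ?_ ?_, ?_,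
    rowArc_disjoint hρ _ hc ?_ ?_, rowArc_disjoint hρ _ hc ?_ ?_, rowArc_disjoint hρ _ hc ?_ ?_,
    rowArc_disjoint hρ _ hc ?_ ?_, rowArc_disjoint hρ _ hc ?_ ?_, rowArc_disjoint hρ _ hc ?_ ?_⟩
  case refine_17 =>
    rw [rowArc_union _ _ _ (by omega) (by omega), rowArc_union _ _ _ (by omega) (by omega),
      rowArc_union _ _ _ (by omega) (by omega), rowArc_eq_range _ _ hc (by omega)]
  all_goals first | omega | (congr 1; push_cast; ring_nf; done) | simp

/-- The two paths that remain of a spanning subgraph of `U` after deletion of the two edges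
`y, y + b` and `y + c, y + c + b` of the row `ρ` may be chosen, for every `c` that is not `0`, `b`
or `-b`, to satisfy `pat`, a condition on the ends `ρ y`, `ρ (y + b)`, `ρ (y + c)`,
`ρ (y + c + b)`. -/
def Splits (ρ : ZMod p → V) (b : ZMod p) (pat : V → V → V → V → Prop) : Prop :=
  ∀ c, c ≠ 0 → c ≠ b → c ≠ -b → ∃ y, pat (ρ y) (ρ (y + b)) (ρ (y + c)) (ρ (y + c + b))

section step

variable [Fact p.Prime] {U : Set V} {ρ ρ' : ZMod p → V} {b c : ZMod p}

/-- Two paths can pair the four ends in three ways. Cutting the old row at distance `c` puts the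
rungs over the ends of two edges of the new row. These edges are dropped, and each old end is
prolonged by a rung and one of the four arcs of `row_split_four`. Following the ends shows that the
three pairings are permuted cyclically. -/
theorem Splits.step (hρ' : Function.Injective ρ') (hUρ : Disjoint U (Set.range ρ'))
    (hrung : ∀ x, X.Adj (ρ x) (ρ' x)) (hb : b ≠ 0) (hc : c ≠ 0) (hbc : b ≠ c) (hbc' : b ≠ -c)
    (hadj : ∀ x, X.Adj (ρ' x) (ρ' (x + c))) :
    (Splits ρ b (fun ly uy lz uz => X.TwoPathsOn U uy lz uz ly) →
      Splits ρ' c (fun ly uy lz uz => X.TwoPathsOn (U ∪ Set.range ρ') uy ly uz lz)) ∧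
    (Splits ρ b (fun ly uy lz uz => X.TwoPathsOn U uy ly uz lz) →
      Splits ρ' c (fun ly uy lz uz => X.TwoPathsOn (U ∪ Set.range ρ') uy uz lz ly)) ∧
    (Splits ρ b (fun ly uy lz uz => X.TwoPathsOn U uy uz lz ly) →
      Splits ρ' c (fun ly uy lz uz => X.TwoPathsOn (U ∪ Set.range ρ') uy lz uz ly)) := by
  have hcb : c ≠ b := hbc.symm
  have hcb' : c ≠ -b := fun h => hbc' (by rw [h, neg_neg])
  refine ⟨fun h j hj hjc hjc' => ?_, fun h j hj hjc hjc' => ?_, fun h j hj hjc hjc' => ?_⟩ <;>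
    obtain ⟨y, hy⟩ := h c hc hcb hcb' <;>
    obtain ⟨y', I₁, I₂, I₃, I₄, h1, h2, h3, h4, hU, h12, h13, h14, h23, h24, h34⟩ :=
      row_split_four hρ' hc hadj y hb hbc hbc' hj hjc hjc' <;>
    refine ⟨y', ?_⟩
  · refine (TwoPathsOn.extend hy h2 h1 h3 h4 (hrung _).symm (hrung _).symm (hrung _).symm
      (hrung _).symm ?_ hUρ h12.symm h23 h24 h13 h14 h34).symm_right
    rw [← hU, Set.union_comm I₁ I₂]
  · refine (TwoPathsOn.extend hy h2 h4 h3 h1 (hrung _).symm (hrung _).symm (hrung _).symm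
      (hrung _).symm ?_ hUρ h24 h23 h12.symm h34.symm h14.symm h13.symm)
    rw [← hU]; ext; simp only [Set.mem_union]; tauto
  · refine (TwoPathsOn.extend hy h2 h3 h1 h4 (hrung _).symm (hrung _).symm (hrung _).symm
      (hrung _).symm ?_ hUρ h23 h12.symm h24 h13.symm h34 h14).symm_right
    rw [← hU]; ext; simp only [Set.mem_union]; tauto

end step

end SimpleGraph

/-! ### Hamilton cycles from six rows -/

namespace SimpleGraph

variable {V : Type*} {X : SimpleGraph V} {p : ℕ}

/-- Six disjoint rows, each indexed by `ZMod p`, that cover all vertices; every vertex is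
adjacent to the vertex with the same index in the next row. -/
structure IsRowSystem (X : SimpleGraph V) (ρ : Fin 6 → ZMod p → V) : Prop where
  eq_of_eq : ∀ s t x y, ρ s x = ρ t y → s = t ∧ x = y
  cover : ∀ v, ∃ t x, ρ t x = v
  rung : ∀ (t : Fin 5) (x : ZMod p), X.Adj (ρ t.castSucc x) (ρ t.succ x)

namespace IsRowSystem

variable {ρ : Fin 6 → ZMod p → V}

theorem injective (h : X.IsRowSystem ρ) (t : Fin 6) : Function.Injective (ρ t) :=
  fun _ _ hxy => (h.eq_of_eq _ _ _ _ hxy).2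

theorem disjoint_range (h : X.IsRowSystem ρ) {s t : Fin 6} (hst : s ≠ t) :
    Disjoint (Set.range (ρ s)) (Set.range (ρ t)) := by
  rw [Set.disjoint_left]
  rintro _ ⟨x, rfl⟩ ⟨y, hy⟩
  exact hst (h.eq_of_eq _ _ _ _ hy).1.symm

theorem two_lt_card [Fintype V] [Fact p.Prime] (h : X.IsRowSystem ρ) : 2 < Fintype.card V := by
  have : Function.Injective fun t : Fin 6 => ρ t 0 := fun s t hst => (h.eq_of_eq _ _ _ _ hst).1
  have := Fintype.card_le_of_injective _ this
  simp at this
  omega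

theorem column_pathOn (h : X.IsRowSystem ρ) (x : ZMod p) :
    X.PathOn (Set.range fun t => ρ t x) (ρ 0 x) (ρ 5 x) := by
  have hd {s t : Fin 6} (hst : s ≠ t) : ρ s x ≠ ρ t x := fun hx => hst (h.eq_of_eq _ _ _ _ hx).1
  have hs (t : Fin 6) : X.PathOn {ρ t x} (ρ t x) (ρ t x) := PathOn.single _
  refine ((((((hs 0).append (h.rung 0 x) (hs 1) ?_).append (h.rung 1 x) (hs 2) ?_).append
    (h.rung 2 x) (hs 3) ?_).append (h.rung 3 x) (hs 4) ?_).append (h.rung 4 x) (hs 5) ?_).congr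
    ?_ rfl rfl
  case refine_6 =>
    ext v
    simp only [Set.mem_union, Set.mem_singleton_iff, Set.mem_range, Fin.exists_fin_succ,
      eq_comm (b := v)]
    simp [or_assoc]
  all_goals
    simp only [Set.disjoint_singleton_right, Set.mem_union, Set.mem_singleton_iff, not_or]
    simp [hd]

variable [Fintype V] [DecidableEq V] [Fact p.Prime]

/-- If the columns close up with a nonzero shift, they form a Hamilton cycle. -/
theorem hamiltonian_of_shift (h : X.IsRowSystem ρ) {c : ZMod p} (hc : c ≠ 0)
    (hadj : ∀ x, X.Adj (ρ 5 x) (ρ 0 (x + c))) :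
    ∃ (v : V) (C : X.Walk v v), C.IsHamiltonianCycle := by
  have hp := (Fact.out : p.Prime).pos
  have hcast : ((p - 1 : ℕ) : ZMod p) = -1 := by
    rw [Nat.cast_sub hp]; simp
  -- The columns are visited in the order `0, c, 2c, …`, which exhausts `ZMod p`; the column `-c`
  -- leads back to `0`.
  have hpath := PathOn.concat (fun k : ℕ => Set.range fun t => ρ t (k * c)) (fun k => ρ 0 (k * c))
    (fun k => ρ 5 (k * c)) (p - 1) (fun k _ => h.column_pathOn _) ?_ ?_
  · refine hpath.exists_isHamiltonianCycle ?_ ?_ h.two_lt_card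
    · refine Set.eq_univ_of_forall fun v => ?_
      obtain ⟨t, x, rfl⟩ := h.cover v
      obtain ⟨m, hm, hx⟩ := ZMod.exists_nat_mul_eq (b := x) hc
      simp only [Set.mem_iUnion]
      exact ⟨m, by omega, t, by rw [hx]⟩
    · convert hadj _ using 2
      rw [hcast]; simp
  · intro i hi j hj
    rw [Set.disjoint_left]
    rintro _ ⟨s, rfl⟩ ⟨t, ht⟩
    have := ZMod.natCast_mul_inj hc (h.eq_of_eq _ _ _ _ ht).2 (by omega) (by omega)
    omega
  · intro i hi
    convert hadj _ using 2
    push_cast; ring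

/-- If no row has the step of the preceding row, up to sign, there is a Hamilton cycle. -/
theorem hamiltonian_of_steps_ne (h : X.IsRowSystem ρ) (s : Fin 6 → ZMod p) (hs : ∀ t, s t ≠ 0)
    (hadj : ∀ t x, X.Adj (ρ t x) (ρ t (x + s t)))
    (hne : ∀ t : Fin 5, s t.castSucc ≠ s t.succ ∧ s t.castSucc ≠ -s t.succ) (hp : 3 < p) :
    ∃ (v : V) (C : X.Walk v v), C.IsHamiltonianCycle := by
  have step (t : Fin 5) (U : Set V) (hU : Disjoint U (Set.range (ρ t.succ))) :=
    Splits.step (h.injective t.succ) hU (h.rung t) (hs t.castSucc) (hs t.succ) (hne t).1 (hne t).2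
      (hadj t.succ)
  have h0 : Splits (ρ 0) (s 0)
      (fun ly uy lz uz => X.TwoPathsOn (Set.range (ρ 0)) uy lz uz ly) :=
    fun c hc _ _ => row_split (h.injective 0) (hs 0) (hadj 0) hc
  have hd {s t : Fin 6} (hst : s ≠ t) := h.disjoint_range hst
  -- The pairing has period three along the rows. Row 5 gets the pairing of row 2, for which
  -- restoring the two deleted edges yields one cycle; the pairing of rows 1 and 4 would yield two.
  have h1 := (step 0 _ (hd (by decide))).1 h0
  have h2 := (step 1 _ (by simp [hd])).2.1 h1
  have h3 := (step 2 _ (by simp [hd])).2.2 h2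
  have h4 := (step 3 _ (by simp [hd])).1 h3
  have h5 := (step 4 _ (by simp [hd])).2.1 h4
  obtain ⟨c, hc0, hc1, hc2⟩ : ∃ c, c ≠ 0 ∧ c ≠ s 5 ∧ c ≠ -s 5 := by
    by_contra! hcon
    have hsub : (Finset.univ : Finset (ZMod p)) ⊆ {0, s 5, -s 5} := by
      intro c _
      simp only [Finset.mem_insert, Finset.mem_singleton]
      by_cases h0 : c = 0
      · exact Or.inl h0
      · by_cases h1 : c = s 5
        · exact Or.inr (Or.inl h1)
        · exact Or.inr (Or.inr (hcon c h0 h1))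
    have := (Finset.card_le_card hsub).trans Finset.card_le_three
    rw [Finset.card_univ, ZMod.card] at this
    omega
  obtain ⟨y, S, T, hST, hU, hS, hT⟩ := h5 c hc0 hc1 hc2
  refine (hS.append (hadj 5 _).symm hT hST).exists_isHamiltonianCycle ?_ (hadj 5 _) h.two_lt_card
  rw [hU]
  refine Set.eq_univ_of_forall fun v => ?_
  obtain ⟨t, x, rfl⟩ := h.cover v
  fin_cases t <;> simp

end IsRowSystem

/-- A new row may be attached to a set `U` that carries, for each `x`, a spanning path between the
vertices `x` and `x + δ` of the last row. -/
theorem PathOn.attach_row [Fact p.Prime] {U : Set V} {ρ ρ' : ZMod p → V} {δ a : ZMod p}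
    (hδ : δ ≠ 0) (ha : a ≠ 0)
    (hU : ∀ x, X.PathOn U (ρ x) (ρ (x + δ))) (hρ' : Function.Injective ρ')
    (hUρ : Disjoint U (Set.range ρ')) (hrung : ∀ x, X.Adj (ρ x) (ρ' x))
    (hadj : ∀ x, X.Adj (ρ' x) (ρ' (x + a))) (x : ZMod p) :
    X.PathOn (U ∪ Set.range ρ') (ρ' x) (ρ' (x + δ)) := by
  obtain ⟨m, hm, rfl⟩ := ZMod.exists_nat_mul_eq (b := δ) ha
  have hm0 : m ≠ 0 := by rintro rfl; simp at hδ
  have hcast : ((p - m : ℕ) : ZMod p) = -m := by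
    rw [Nat.cast_sub hm.le]; simp
  have hcast' : ((p - m - 1 : ℕ) : ZMod p) = -m - 1 := by
    rw [Nat.cast_sub (by omega), hcast]; simp
  have hcast1 : ((p - 1 : ℕ) : ZMod p) = -1 := by
    rw [Nat.cast_sub (by omega)]; simp
  have path {i j : ℕ} (hij : i ≤ j) (hj : j < i + p) :=
    rowArc_pathOn (y := x + m * a) hρ' ha hadj hij hj
  -- The new row splits into the arcs from `x + δ` to `x - a` and from `x` to `x + δ - a`. The path
  -- passes to `U` at `x - a` and comes back at `x - a + δ`, which again differ by `δ`.
  have h1 := path (i := 0) (j := p - m - 1) (by omega) (by omega)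
  have h2 := path (i := p - m - 1 + 1) (j := p - 1) (by omega) (by omega)
  have hsub (i j : ℕ) := rowArc_subset ρ' (x + m * a) a i j
  have h3 := (h1.append (hrung _).symm (hU _) (hUρ.symm.mono_left (hsub _ _))).append (hrung _)
    (h2.symm.congr rfl ?_ rfl) ?_
  · refine h3.symm.congr ?_ ?_ ?_
    · rw [← rowArc_eq_range ρ' (x + m * a) ha (a := 0) (b := p - 1) (by omega),
        ← rowArc_union ρ' (x + m * a) a (a := 0) (b := p - m - 1) (d := p - 1) (by omega) (by omega)]
      ext; simp only [Set.mem_union]; tauto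
    · push_cast [hcast']; congr 1; ring
    · simp
  · rw [hcast1, hcast']; congr 1; ring
  · rw [Set.disjoint_union_left]
    exact ⟨rowArc_disjoint hρ' _ ha (by omega) (by omega), hUρ.mono_right (hsub _ _)⟩

/-- If the first and the last row have the same step, up to sign, there is a Hamilton cycle. -/
theorem IsRowSystem.hamiltonian_of_step_eq [Fintype V] [DecidableEq V] [Fact p.Prime]
    {ρ : Fin 6 → ZMod p → V} (h : X.IsRowSystem ρ) (s : Fin 6 → ZMod p) (hs : ∀ t, s t ≠ 0)
    (hadj : ∀ t x, X.Adj (ρ t x) (ρ t (x + s t))) (heq : s 5 = s 0 ∨ s 5 = -s 0) :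
    ∃ (v : V) (C : X.Walk v v), C.IsHamiltonianCycle := by
  have step (t : Fin 5) (U : Set V) (hU : Disjoint U (Set.range (ρ t.succ)))
      (hpath : ∀ x, X.PathOn U (ρ t.castSucc x) (ρ t.castSucc (x + s 0))) :=
    PathOn.attach_row (hs 0) (hs t.succ) hpath (h.injective t.succ) hU (h.rung t) (hadj t.succ)
  have hd {s t : Fin 6} (hst : s ≠ t) := h.disjoint_range hst
  have h0 (x) := (row_pathOn (h.injective 0) (hs 0) (hadj 0) x).symm
  have h1 := step 0 _ (hd (by decide)) h0
  have h2 := step 1 _ (by simp [hd]) h1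
  have h3 := step 2 _ (by simp [hd]) h2
  have h4 := step 3 _ (by simp [hd]) h3
  -- The last row minus one edge joins the vertices matched to the ends of the path on the first
  -- five rows, its step being `±s 0`.
  have hrow : X.PathOn (Set.range (ρ 5)) (ρ 5 (0 + s 0)) (ρ 5 0) := by
    have := row_pathOn (h.injective 5) (hs 5) (hadj 5)
    rcases heq with heq | heq
    · rw [← heq]; exact this 0
    · refine (this (s 0)).symm.congr rfl ?_ ?_
      · rw [zero_add]
      · rw [heq]; simp
  refine ((h4 0).append (h.rung 4 _) hrow (by simp [hd])).exists_isHamiltonianCycle ?_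
    (h.rung 4 0).symm h.two_lt_card
  refine Set.eq_univ_of_forall fun v => ?_
  obtain ⟨t, x, rfl⟩ := h.cover v
  fin_cases t <;> simp

end SimpleGraph

namespace SimpleGraph

/-! ### Regular graphs with six vertices -/

/-- The edges of the regular graphs with six vertices. -/
def sixTable (k : Fin 8) : List (ℕ × ℕ) :=
  match k with
  | 0 => [(0,1),(1,2),(2,3),(3,4),(4,5),(0,5)]
  | 1 => [(0,1),(1,2),(2,3),(3,4),(4,5),(0,5),(0,2),(3,5),(1,4)]
  | 2 => [(0,1),(1,2),(2,3),(3,4),(4,5),(0,5),(0,3),(1,4),(2,5)]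
  | 3 => [(0,1),(1,2),(2,3),(3,4),(4,5),(0,5),(0,2),(1,3),(2,4),(3,5),(0,4),(1,5)]
  | 4 => [(0,1),(1,2),(2,3),(3,4),(4,5),(0,5),(0,2),(1,3),(2,4),(3,5),(0,4),(1,5),(0,3),(1,4),
      (2,5)]
  | 5 => []
  | 6 => [(0,3),(1,4),(2,5)]
  | 7 => [(0,2),(2,4),(0,4),(1,3),(3,5),(1,5)]

/-- The adjacency matrices of the regular graphs with six vertices: in this order the hexagon, the
prism, `K₃,₃`, the octahedron, `K₆` and the three disconnected graphs. -/
def sixGraph (k : Fin 8) (s t : Fin 6) : Bool :=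
  (sixTable k).contains (s.val, t.val) || (sixTable k).contains (t.val, s.val)

/-- The symmetric Boolean matrix with the given entries above the diagonal. -/
def symMatrix (a b c d e f g h i j k l m n o : Bool) : Fin 6 → Fin 6 → Bool :=
  ![![false, a, b, c, d, e], ![a, false, f, g, h, i], ![b, f, false, j, k, l],
    ![c, g, j, false, m, n], ![d, h, k, m, false, o], ![e, i, l, n, o, false]]

/-- The sum of a row of a symmetric Boolean matrix off the diagonal. -/
def rowSum (a b c d e : Bool) : ℕ := a.toNat + b.toNat + c.toNat + d.toNat + e.toNat

/-- The matrices `A` and `B` agree after a relabelling of `A` that fixes `0`. -/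
def agree (A B : Fin 6 → Fin 6 → Bool) : Bool :=
  (List.finRange 6).any fun x₁ => A 0 x₁ == B 0 1 && x₁ != 0 &&
  (List.finRange 6).any fun x₂ => A 0 x₂ == B 0 2 && A x₁ x₂ == B 1 2 && x₂ != 0 && x₂ != x₁ &&
  (List.finRange 6).any fun x₃ => A 0 x₃ == B 0 3 && A x₁ x₃ == B 1 3 && A x₂ x₃ == B 2 3 &&
    x₃ != 0 && x₃ != x₁ && x₃ != x₂ &&
  (List.finRange 6).any fun x₄ => A 0 x₄ == B 0 4 && A x₁ x₄ == B 1 4 && A x₂ x₄ == B 2 4 &&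
    A x₃ x₄ == B 3 4 && x₄ != 0 && x₄ != x₁ && x₄ != x₂ && x₄ != x₃ &&
  (List.finRange 6).any fun x₅ => A 0 x₅ == B 0 5 && A x₁ x₅ == B 1 5 && A x₂ x₅ == B 2 5 &&
    A x₃ x₅ == B 3 5 && A x₄ x₅ == B 4 5 && x₅ != 0 && x₅ != x₁ && x₅ != x₂ && x₅ != x₃ && x₅ != x₄

-- An exhaustive check. The row sum conditions stand between the quantifiers so that irregular
-- matrices are discarded early. A relabelling that fixes `0` suffices because the eight graphs are
-- vertex-transitive; the literal vector lists their degrees.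
set_option maxRecDepth 100000 in
theorem exists_agree_sixGraph : ∀ a b c d e f g h i : Bool,
    rowSum a b c d e = rowSum a f g h i →
    ∀ j k l, rowSum a b c d e = rowSum b f j k l →
    ∀ m n, rowSum a b c d e = rowSum c g j m n →
    ∀ o, rowSum a b c d e = rowSum d h k m o → rowSum a b c d e = rowSum e i l n o →
    ((List.finRange 8).any fun q => rowSum a b c d e == ![2, 3, 3, 4, 5, 0, 1, 2] q &&
      agree (symMatrix a b c d e f g h i j k l m n o) (sixGraph q)) = true := by
  decide +kernel

theorem sixGraph_symm : ∀ k s t, sixGraph k s t = sixGraph k t s := by decide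

theorem sixGraph_self : ∀ k s, sixGraph k s s = false := by decide

theorem exists_equiv_sixGraph {ι : Type*} [Fintype ι] (hι : Fintype.card ι = 6)
    (Y : SimpleGraph ι) [DecidableRel Y.Adj] {d : ℕ} (hreg : ∀ i, Y.degree i = d) :
    ∃ (k : Fin 8) (e : Fin 6 ≃ ι), ∀ s t, Y.Adj (e s) (e t) ↔ sixGraph k s t = true := by
  obtain ⟨e₀⟩ : Nonempty (Fin 6 ≃ ι) := ⟨(Fintype.equivFinOfCardEq hι).symm⟩
  obtain ⟨A, hA⟩ : ∃ A : Fin 6 → Fin 6 → Bool, ∀ s t, A s t = decide (Y.Adj (e₀ s) (e₀ t)) :=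
    ⟨_, fun _ _ => rfl⟩
  have hsymm (s t) : A s t = A t s := by simp [hA, Y.adj_comm]
  have hself (s) : A s s = false := by simp [hA]
  have hdeg (s) : ∑ t, (A s t).toNat = d := by
    rw [← hreg (e₀ s), ← card_neighborFinset_eq_degree, neighborFinset_eq_filter,
      Finset.card_filter, ← e₀.sum_comp]
    refine Finset.sum_congr rfl fun t _ => ?_
    rw [hA]
    by_cases h : Y.Adj (e₀ s) (e₀ t) <;> simp [h]
  have hmat : symMatrix (A 0 1) (A 0 2) (A 0 3) (A 0 4) (A 0 5) (A 1 2) (A 1 3) (A 1 4) (A 1 5)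
      (A 2 3) (A 2 4) (A 2 5) (A 3 4) (A 3 5) (A 4 5) = A := by
    funext s t
    fin_cases s <;> fin_cases t <;> first | exact (hself _).symm | rfl | exact hsymm _ _
  have hd (s) := hdeg s
  simp only [Fin.sum_univ_six] at hd
  have h0 := hd 0
  have h1 := hd 1
  have h2 := hd 2
  have h3 := hd 3
  have h4 := hd 4
  have h5 := hd 5
  rw [hself] at h0 h1 h2 h3 h4 h5
  rw [hsymm 1 0] at h1
  rw [hsymm 2 0, hsymm 2 1] at h2
  rw [hsymm 3 0, hsymm 3 1, hsymm 3 2] at h3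
  rw [hsymm 4 0, hsymm 4 1, hsymm 4 2, hsymm 4 3] at h4
  rw [hsymm 5 0, hsymm 5 1, hsymm 5 2, hsymm 5 3, hsymm 5 4] at h5
  have key := exists_agree_sixGraph (A 0 1) (A 0 2) (A 0 3) (A 0 4) (A 0 5) (A 1 2) (A 1 3)
    (A 1 4) (A 1 5) (by simp only [rowSum, Bool.toNat_false] at *; omega) (A 2 3) (A 2 4) (A 2 5)
    (by simp only [rowSum, Bool.toNat_false] at *; omega) (A 3 4) (A 3 5)
    (by simp only [rowSum, Bool.toNat_false] at *; omega) (A 4 5)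
    (by simp only [rowSum, Bool.toNat_false] at *; omega)
    (by simp only [rowSum, Bool.toNat_false] at *; omega)
  rw [hmat] at key
  simp only [agree, List.any_eq_true, Bool.and_eq_true, beq_iff_eq, bne_iff_ne] at key
  obtain ⟨k, -, -, x₁, -, h1, x₂, -, h2, x₃, -, h3, x₄, -, h4, x₅, -, h5⟩ := key
  have hinj : Function.Injective ![0, x₁, x₂, x₃, x₄, x₅] := by
    rw [← List.nodup_ofFn]
    simp only [List.ofFn_succ, List.nodup_cons]
    simp
    grind
  have hbij := Finite.injective_iff_bijective.mp hinj
  refine ⟨k, (Equiv.ofBijective _ hbij).trans e₀, fun s t => ?_⟩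
  simp only [Equiv.trans_apply, Equiv.ofBijective_apply]
  have : A (![0, x₁, x₂, x₃, x₄, x₅] s) (![0, x₁, x₂, x₃, x₄, x₅] t) = sixGraph k s t := by
    have hlt : ∀ s t : Fin 6, s < t →
        A (![0, x₁, x₂, x₃, x₄, x₅] s) (![0, x₁, x₂, x₃, x₄, x₅] t) = sixGraph k s t := by
      intro s t hst
      fin_cases s <;> fin_cases t <;>
        first | exact absurd hst (by decide) | simp [h1, h2, h3, h4, h5]
    rcases lt_trichotomy s t with h | h | h
    · exact hlt s t h
    · rw [h, hself, sixGraph_self]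
    · rw [hsymm, sixGraph_symm, hlt t s h]
  rw [← this, hA, decide_eq_true_iff]

/-- The form in which connectedness yields contradictions: against a disconnected quotient, against
trivial voltages, and against a lack of edges between moved and fixed vertices. -/
theorem Preconnected.eq_of_forall_adj {V α : Type*} {X : SimpleGraph V} (h : X.Preconnected)
    (φ : V → α) (hφ : ∀ u v, X.Adj u v → φ u = φ v) (u v : V) : φ u = φ v := by
  obtain ⟨w⟩ := h u v
  induction w with
  | nil => rfl
  | cons hadj _ ih => exact (hφ _ _ hadj).trans ih

theorem exists_equiv_sixGraph_of_connected {ι : Type*} [Fintype ι] (hι : Fintype.card ι = 6)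
    (Y : SimpleGraph ι) [DecidableRel Y.Adj] {d : ℕ} (hreg : ∀ i, Y.degree i = d)
    (hconn : Y.Connected) :
    ∃ (k : Fin 8) (e : Fin 6 ≃ ι), k < 5 ∧ ∀ s t, Y.Adj (e s) (e t) ↔ sixGraph k s t = true := by
  obtain ⟨k, e, he⟩ := exists_equiv_sixGraph hι Y hreg
  refine ⟨k, e, ?_, he⟩
  by_contra hk
  -- `T` marks the component of `0`, which does not contain `1` in any of the three disconnected
  -- graphs.
  obtain ⟨T, hT, hT'⟩ : ∃ T : Fin 6 → Bool, (∀ s t, sixGraph k s t = true → T s = T t) ∧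
      T 0 ≠ T 1 := by
    rcases (by decide : ∀ k : Fin 8, ¬k < 5 → k = 5 ∨ k = 6 ∨ k = 7) k hk with rfl | rfl | rfl
    · exact ⟨![true, false, false, false, false, false], by decide, by decide⟩
    · exact ⟨![true, false, false, true, false, false], by decide, by decide⟩
    · exact ⟨![true, false, true, false, true, false], by decide, by decide⟩
  have := hconn.preconnected.eq_of_forall_adj (fun i => T (e.symm i)) (fun i j hij => hT _ _ (by
    rw [← he]; simpa using hij)) (e 0) (e 1)
  simp only [Equiv.symm_apply_apply] at this
  exact hT' this

/-- Hamilton cycles of the connected regular graphs with six vertices. -/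
def sixCycles : List (Fin 6 → Fin 6) :=
  [id, ![1, 2, 0, 5, 3, 4], ![0, 1, 2, 5, 4, 3], ![1, 2, 3, 0, 5, 4], ![0, 2, 1, 3, 4, 5],
    ![0, 3, 2, 1, 5, 4]]

-- The rotation `r` moves the given edge to the closing position, and the translation `m` keeps the
-- list of cycles short. Translations need not be automorphisms, so adjacency is checked after
-- translating.
set_option maxRecDepth 100000 in
theorem exists_sixCycle : ∀ k : Fin 8, k < 5 → ∀ i j, sixGraph k i j = true →
    ∃ c ∈ sixCycles, ∃ r : Fin 6, ∃ m : Fin 6,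
      (∀ t, sixGraph k (m + c (r + t)) (m + c (r + (t + 1))) = true) ∧
      ((m + c (r + 5) = i ∧ m + c (r + 0) = j) ∨ (m + c (r + 5) = j ∧ m + c (r + 0) = i)) := by
  decide +kernel

theorem sixCycles_injective : ∀ c ∈ sixCycles, Function.Injective c := by
  intro c hc
  simp only [sixCycles, List.mem_cons, List.not_mem_nil, or_false] at hc
  rcases hc with rfl | rfl | rfl | rfl | rfl | rfl
  · exact Function.injective_id
  all_goals
    unfold Function.Injective
    decide

/-- Every edge of a connected regular graph with six vertices lies on a Hamilton cycle. -/
theorem exists_hamiltonian_six_cycle {ι : Type*} [Fintype ι] (hι : Fintype.card ι = 6)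
    (Y : SimpleGraph ι) [DecidableRel Y.Adj] {d : ℕ} (hreg : ∀ i, Y.degree i = d)
    (hconn : Y.Connected) {i j : ι} (hij : Y.Adj i j) :
    ∃ c : Fin 6 → ι, Function.Injective c ∧ (∀ t, Y.Adj (c t) (c (t + 1))) ∧
      ((c 5 = i ∧ c 0 = j) ∨ (c 5 = j ∧ c 0 = i)) := by
  obtain ⟨k, e, hk, he⟩ := exists_equiv_sixGraph_of_connected hι Y hreg hconn
  obtain ⟨c, hc, r, m, hadj, h⟩ := exists_sixCycle k hk (e.symm i) (e.symm j)
    (by rw [← he]; simpa using hij)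
  refine ⟨fun t => e (m + c (r + t)), ?_, fun t => (he _ _).mpr (hadj t), ?_⟩
  · intro s t hst
    exact add_left_cancel (sixCycles_injective c hc (add_left_cancel (e.injective hst)))
  · simpa only [← Equiv.eq_symm_apply] using h

end SimpleGraph

/-! ### Cyclic coordinates, voltages and lifts -/

namespace SimpleGraph

variable {V ι : Type*} {X : SimpleGraph V} {p : ℕ}

/-- The quotient graph of `X` with respect to the fibres of `b`. -/
def blockGraph (X : SimpleGraph V) (b : V → ι) : SimpleGraph ι where
  Adj i j := i ≠ j ∧ ∃ x y, b x = i ∧ b y = j ∧ X.Adj x y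
  symm := ⟨fun _ _ ⟨hne, x, y, hx, hy, h⟩ => ⟨hne.symm, y, x, hy, hx, h.symm⟩⟩
  loopless := ⟨fun _ h => h.1 rfl⟩

/-- Coordinates on `X` for which the blocks, the fibres of `b`, are indexed by `ZMod p` and
translation of all indices preserves adjacency. -/
structure IsCyclicSystem (X : SimpleGraph V) (b : V → ι) (f : ι → ZMod p → V) : Prop where
  block : ∀ i x, b (f i x) = i
  injective : ∀ i, Function.Injective (f i)
  cover : ∀ v, ∃ x, f (b v) x = v
  translate : ∀ i j x y z, X.Adj (f i x) (f j y) → X.Adj (f i (x + z)) (f j (y + z))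

namespace IsCyclicSystem

variable {b : V → ι} {f : ι → ZMod p → V}

theorem adj_iff (h : X.IsCyclicSystem b f) {i j : ι} {x y : ZMod p} :
    X.Adj (f i x) (f j y) ↔ X.Adj (f i 0) (f j (y - x)) := by
  constructor
  · intro hadj
    have := h.translate _ _ _ _ (-x) hadj
    rwa [add_neg_cancel, ← sub_eq_add_neg] at this
  · intro hadj
    have := h.translate _ _ _ _ x hadj
    rwa [zero_add, sub_add_cancel] at this

theorem adj_neg (h : X.IsCyclicSystem b f) {i j : ι} {z : ZMod p} (hz : X.Adj (f i 0) (f j z)) :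
    X.Adj (f j 0) (f i (-z)) := by
  have := h.adj_iff.mp hz.symm
  rwa [zero_sub] at this

theorem exists_voltage (h : X.IsCyclicSystem b f) {i j : ι} (hij : (X.blockGraph b).Adj i j) :
    ∃ w, X.Adj (f i 0) (f j w) := by
  obtain ⟨-, x, y, rfl, rfl, hxy⟩ := hij
  obtain ⟨x', hx'⟩ := h.cover x
  obtain ⟨y', hy'⟩ := h.cover y
  rw [← hx', ← hy', h.adj_iff] at hxy
  exact ⟨_, hxy⟩

/-- Rows along a spanning path of blocks, shifted by a potential. -/
theorem isRowSystem (h : X.IsCyclicSystem b f) {c : Fin 6 → ι} (hc : Function.Bijective c)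
    (g : Fin 6 → ZMod p)
    (hg : ∀ t : Fin 5, X.Adj (f (c t.castSucc) 0) (f (c t.succ) (g t.succ - g t.castSucc))) :
    X.IsRowSystem fun t x => f (c t) (x + g t) where
  eq_of_eq s t x y hxy := by
    have h1 := congrArg b hxy
    rw [h.block, h.block] at h1
    obtain rfl := hc.1 h1
    exact ⟨rfl, add_right_cancel (h.injective _ hxy)⟩
  cover v := by
    obtain ⟨t, ht⟩ := hc.2 (b v)
    obtain ⟨x, hx⟩ := h.cover v
    exact ⟨t, x - g t, by rw [sub_add_cancel, ht, hx]⟩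
  rung t x := by
    rw [h.adj_iff]
    convert hg t using 2
    ring

/-- The partial sums of a sequence of voltages. -/
def partialSums (w : Fin 6 → ZMod p) : Fin 6 → ZMod p :=
  ![0, w 0, w 0 + w 1, w 0 + w 1 + w 2, w 0 + w 1 + w 2 + w 3, w 0 + w 1 + w 2 + w 3 + w 4]

theorem isRowSystem_partialSums (h : X.IsCyclicSystem b f) {c : Fin 6 → ι}
    (hc : Function.Bijective c) (w : Fin 6 → ZMod p)
    (hw : ∀ t : Fin 5, X.Adj (f (c t.castSucc) 0) (f (c t.succ) (w t.castSucc))) :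
    X.IsRowSystem fun t x => f (c t) (x + partialSums w t) := by
  refine h.isRowSystem hc _ fun t => ?_
  convert hw t using 2
  fin_cases t <;> simp [partialSums]

variable [Fintype V] [DecidableEq V] [Fact p.Prime]

/-- A Hamilton cycle of blocks with nonzero total voltage lifts to a Hamilton cycle. -/
theorem hamiltonian_of_voltage (h : X.IsCyclicSystem b f) {c : Fin 6 → ι}
    (hc : Function.Bijective c) (w : Fin 6 → ZMod p)
    (hw : ∀ t, X.Adj (f (c t) 0) (f (c (t + 1)) (w t))) (hsum : ∑ t, w t ≠ 0) :
    ∃ (v : V) (C : X.Walk v v), C.IsHamiltonianCycle := by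
  have hrow := h.isRowSystem_partialSums hc w (fun t => by
    have := hw t.castSucc
    rwa [Fin.coeSucc_eq_succ] at this)
  -- The potential absorbs the first five voltages, so the closing shift is the total voltage.
  refine hrow.hamiltonian_of_shift hsum fun x => ?_
  rw [h.adj_iff]
  convert hw 5 using 2
  · rfl
  · simp [partialSums, Fin.sum_univ_six]

/-- A Hamilton cycle of blocks gives a Hamilton cycle if there are edges inside all blocks. -/
theorem hamiltonian_of_inner (h : X.IsCyclicSystem b f) (hp : 3 < p) {c : Fin 6 → ι}
    (hc : Function.Bijective c) (hadj : ∀ t, (X.blockGraph b).Adj (c t) (c (t + 1)))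
    (s : ι → ZMod p) (hs : ∀ i, X.Adj (f i 0) (f i (s i))) :
    ∃ (v : V) (C : X.Walk v v), C.IsHamiltonianCycle := by
  have hs0 (i) : s i ≠ 0 := fun h0 => X.loopless.irrefl _ (h0 ▸ hs i)
  have main {c : Fin 6 → ι} (hc : Function.Bijective c)
      (hadj : ∀ t, (X.blockGraph b).Adj (c t) (c (t + 1)))
      (hst : (s (c 5) = s (c 0) ∨ s (c 5) = -s (c 0)) ∨ ∀ t : Fin 5,
        s (c t.castSucc) ≠ s (c t.succ) ∧ s (c t.castSucc) ≠ -s (c t.succ)) :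
      ∃ (v : V) (C : X.Walk v v), C.IsHamiltonianCycle := by
    choose w hw using fun t => h.exists_voltage (hadj t)
    have hrow := h.isRowSystem_partialSums hc w (fun t => by
      have := hw t.castSucc
      rwa [Fin.coeSucc_eq_succ] at this)
    have hstep (t : Fin 6) (x : ZMod p) : X.Adj (f (c t) (x + partialSums w t))
        (f (c t) (x + s (c t) + partialSums w t)) := by
      rw [h.adj_iff]
      convert hs (c t) using 2
      ring
    rcases hst with hst | hst
    · exact hrow.hamiltonian_of_step_eq (fun t => s (c t)) (fun t => hs0 _) hstep hst
    · exact hrow.hamiltonian_of_steps_ne (fun t => s (c t)) (fun t => hs0 _) hstep hst hp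
  by_cases hex : ∃ t, s (c t) = s (c (t + 1)) ∨ s (c t) = -s (c (t + 1))
  · obtain ⟨t, ht⟩ := hex
    -- After this rotation of the cycle, the two blocks with equal steps are the first and the last.
    refine main (c := fun r => c (t + 1 + r)) (hc.comp (Equiv.addLeft (t + 1)).bijective)
      (fun r => ?_) (Or.inl ?_)
    · rw [← add_assoc]; exact hadj _
    · have h5 : t + 1 + 5 = t := by rw [add_assoc]; exact add_zero t
      rwa [h5, add_zero]
  · push Not at hex
    refine main hc hadj (Or.inr fun t => ?_)
    rw [← Fin.coeSucc_eq_succ]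
    exact hex _

end IsCyclicSystem

/-- Two triangles of blocks that are closed up with opposite nonzero shifts. -/
theorem IsRowSystem.hamiltonian_of_prism [Fintype V] [DecidableEq V] [Fact p.Prime]
    {ρ : Fin 6 → ZMod p → V} (h : X.IsRowSystem ρ) {c : ZMod p} (hc : c ≠ 0)
    (h20 : ∀ x, X.Adj (ρ 2 x) (ρ 0 (x + c))) (h53 : ∀ x, X.Adj (ρ 5 x) (ρ 3 (x - c)))
    (h50 : ∀ x, X.Adj (ρ 5 x) (ρ 0 x)) :
    ∃ (v : V) (C : X.Walk v v), C.IsHamiltonianCycle := by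
  have hp := (Fact.out : p.Prime).pos
  have hcast : ((p - 1 : ℕ) : ZMod p) = -1 := by
    rw [Nat.cast_sub hp]; simp
  have hd {s t : Fin 6} (hst : s ≠ t) (x y : ZMod p) : ρ s x ≠ ρ t y :=
    fun hx => hst (h.eq_of_eq _ _ _ _ hx).1
  have hA (x) : X.PathOn ({ρ 0 x} ∪ {ρ 1 x} ∪ {ρ 2 x}) (ρ 0 x) (ρ 2 x) :=
    ((PathOn.single _).append (h.rung 0 x) (PathOn.single _) (by simp [hd])).append (h.rung 1 x)
      (PathOn.single _) (by simp [hd])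
  have hB (x) : X.PathOn ({ρ 3 x} ∪ {ρ 4 x} ∪ {ρ 5 x}) (ρ 3 x) (ρ 5 x) :=
    ((PathOn.single _).append (h.rung 3 x) (PathOn.single _) (by simp [hd])).append (h.rung 4 x)
      (PathOn.single _) (by simp [hd])
  have hne {i j : ℕ} (hi : i ≤ p - 1) (hj : j < i) : (j : ZMod p) * c ≠ i * c := fun hij => by
    have := ZMod.natCast_mul_inj hc hij (by omega) (by omega)
    omega
  have hinj {t : Fin 6} {x y : ZMod p} : ρ t x = ρ t y ↔ x = y := (h.injective t).eq_iff
  -- The first triangle is wound through at the indices `0, c, …, -c`. The path then crosses to the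
  -- second triangle at `-c`, whose opposite shift gives the indices `-c, -2c, …, 0`, so that `h50`
  -- closes the cycle at `0`.
  have h1 := PathOn.concat (fun k : ℕ => {ρ 0 (k * c)} ∪ {ρ 1 (k * c)} ∪ {ρ 2 (k * c)})
    (fun k => ρ 0 (k * c)) (fun k => ρ 2 (k * c)) (p - 1) (fun k _ => hA _)
    (fun i hi j hj => by simp [hd, hinj, (hne hi hj).symm])
    (fun i _ => by convert h20 (i * c) using 2; push_cast; ring)
  have h2 := PathOn.concat
    (fun k : ℕ => {ρ 3 (-c - k * c)} ∪ {ρ 4 (-c - k * c)} ∪ {ρ 5 (-c - k * c)})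
    (fun k => ρ 3 (-c - k * c)) (fun k => ρ 5 (-c - k * c)) (p - 1) (fun k _ => hB _)
    (fun i hi j hj => by simp [hd, hinj, (hne hi hj).symm])
    (fun i _ => by convert h53 (-c - i * c) using 2; push_cast; ring)
  refine (h1.append ?_ h2 ?_).exists_isHamiltonianCycle ?_ ?_ h.two_lt_card
  · have h23 : ∀ x, X.Adj (ρ 2 x) (ρ 3 x) := h.rung 2
    convert h23 (-c) using 2
    · rw [hcast]; simp
    · simp
  · simp [hd]
  · refine Set.eq_univ_of_forall fun v => ?_
    obtain ⟨t, x, rfl⟩ := h.cover v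
    obtain ⟨m, hm, rfl⟩ := ZMod.exists_nat_mul_eq (b := x) hc
    obtain ⟨n, hn, hx⟩ := ZMod.exists_nat_mul_eq (b := -c - (m : ZMod p) * c) hc
    have hx' : (m : ZMod p) * c = -c - n * c := by rw [hx]; ring
    have hm' : m ≤ p - 1 := by omega
    have hn' : n ≤ p - 1 := by omega
    simp only [Set.mem_union, Set.mem_iUnion, Set.mem_singleton_iff, exists_prop]
    fin_cases t
    · exact Or.inl ⟨m, hm', by simp⟩
    · exact Or.inl ⟨m, hm', by simp⟩
    · exact Or.inl ⟨m, hm', by simp⟩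
    · exact Or.inr ⟨n, hn', by simp [hx']⟩
    · exact Or.inr ⟨n, hn', by simp [hx']⟩
    · exact Or.inr ⟨n, hn', by simp [hx']⟩
  · convert h50 0 using 2
    · rw [hcast]; ring
    · simp

end SimpleGraph

/-! ### Systems without edges inside the blocks -/

namespace SimpleGraph

/-- Voltages on a connected regular graph with six vertices that vanish on a Hamilton cycle and
have sum zero along all Hamilton cycles vanish, except possibly on the prism. -/
theorem voltage_eq_zero_or_prism {F : Type*} [Field F] (h2 : (2 : F) ≠ 0) (h3 : (3 : F) ≠ 0)
    {k : Fin 8} (hk : k < 5) (r : Fin 6 → Fin 6 → F)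
    (hneg : ∀ s t, sixGraph k s t = true → r t s = -r s t) (hcyc : ∀ t, r t (t + 1) = 0)
    (hr : ∀ c : Fin 6 → Fin 6, Function.Injective c →
      (∀ t, sixGraph k (c t) (c (t + 1)) = true) → ∑ t, r (c t) (c (t + 1)) = 0) :
    (∀ s t, sixGraph k s t = true → r s t = 0) ∨ (k = 1 ∧ r 0 2 ≠ 0 ∧ r 3 5 = -r 0 2) := by
  have h01 : r 0 1 = 0 := hcyc 0
  have h12 : r 1 2 = 0 := hcyc 1
  have h23 : r 2 3 = 0 := hcyc 2
  have h34 : r 3 4 = 0 := hcyc 3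
  have h45 : r 4 5 = 0 := hcyc 4
  have h50 : r 5 0 = 0 := hcyc 5
  have hcyc' (t) : r (t + 1) t = 0 := by
    rw [hneg t (t + 1), hcyc, neg_zero]
    have : ∀ k : Fin 8, k < 5 → ∀ t, sixGraph k t (t + 1) = true := by decide
    exact this k hk t
  have h10 : r 1 0 = 0 := hcyc' 0
  have h21 : r 2 1 = 0 := hcyc' 1
  have h32 : r 3 2 = 0 := hcyc' 2
  have h43 : r 4 3 = 0 := hcyc' 3
  have h54 : r 5 4 = 0 := hcyc' 4
  have h05 : r 0 5 = 0 := hcyc' 5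
  have sum_eq (c : Fin 6 → Fin 6) (h : Function.Injective c)
      (h' : ∀ t, sixGraph k (c t) (c (t + 1)) = true) :
      r (c 0) (c 1) + r (c 1) (c 2) + r (c 2) (c 3) + r (c 3) (c 4) + r (c 4) (c 5) +
        r (c 5) (c 0) = 0 := by
    have := hr c h h'
    rwa [Fin.sum_univ_six] at this
  have key (hlt : ∀ s t, s < t → sixGraph k s t = true → r s t = 0) :
      ∀ s t, sixGraph k s t = true → r s t = 0 := by
    intro s t hst
    rcases lt_trichotomy s t with h | h | h
    · exact hlt s t h hst
    · rw [h, sixGraph_self] at hst; cases hst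
    · rw [hneg t s (by rwa [sixGraph_symm]), hlt t s h (by rwa [sixGraph_symm]), neg_zero]
  have hinj {c : Fin 6 → Fin 6} (h : ∀ s t, c s = c t → s = t) : Function.Injective c :=
    fun s t => h s t
  rcases (by decide : ∀ k : Fin 8, k < 5 → k = 0 ∨ k = 1 ∨ k = 2 ∨ k = 3 ∨ k = 4) k hk with
    rfl | rfl | rfl | rfl | rfl
  · left
    apply key
    intro s t hst hadj
    fin_cases s <;> fin_cases t <;> 
      first | assumption | exact absurd hst (by decide) | exact absurd hadj (by decide)
  -- Both cycles traverse the triangle chords as `2 → 0` and `5 → 3`, but the chord between `1` and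
  -- `4` in opposite directions. This kills `r 1 4` and leaves only a relation between the two
  -- triangles.
  · have e1 := sum_eq ![1, 2, 0, 5, 3, 4] (hinj (by decide)) (by decide)
    have e2 := sum_eq ![2, 0, 1, 4, 5, 3] (hinj (by decide)) (by decide)
    have n1 := hneg 0 2 (by decide)
    have n2 := hneg 3 5 (by decide)
    have n3 := hneg 1 4 (by decide)
    simp only [Matrix.cons_val, h01, h12, h34, h45, h05, h32] at e1 e2
    have h14 : r 1 4 = 0 := by
      have : 2 * r 1 4 = 0 := by linear_combination e2 - e1 + n3
      simpa [h2] using this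
    have h35 : r 3 5 = -r 0 2 := by linear_combination -e2 + h14 + n1 + n2
    by_cases h02 : r 0 2 = 0
    · left
      rw [h02, neg_zero] at h35
      apply key
      intro s t hst hadj
      fin_cases s <;> fin_cases t <;> 
      first | assumption | exact absurd hst (by decide) | exact absurd hadj (by decide)
    · exact Or.inr ⟨rfl, h02, h35⟩
  · left
    -- Eliminating two of the three diagonals leaves `3 * r 0 3 = 0`.
    have e1 := sum_eq ![0, 1, 2, 5, 4, 3] (hinj (by decide)) (by decide)
    have e2 := sum_eq ![1, 2, 3, 0, 5, 4] (hinj (by decide)) (by decide)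
    have e3 := sum_eq ![0, 3, 4, 1, 2, 5] (hinj (by decide)) (by decide)
    have n1 := hneg 0 3 (by decide)
    have n2 := hneg 1 4 (by decide)
    simp only [Matrix.cons_val, h01, h12, h34, h50, h05, h54, h43, h23] at e1 e2 e3
    have h03 : r 0 3 = 0 := by
      have : 3 * r 0 3 = 0 := by linear_combination e3 - e1 - e2 + 2 * n1
      simpa [h3] using this
    have h14 : r 1 4 = 0 := by linear_combination -e2 + n1 + n2 - h03
    have h25 : r 2 5 = 0 := by linear_combination e1 - n1 + h03
    apply key
    intro s t hst hadj
    fin_cases s <;> fin_cases t <;> 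
      first | assumption | exact absurd hst (by decide) | exact absurd hadj (by decide)
  · left
    -- `e0` to `e4` make the chords from `t` to `t + 2` alternate in sign; `e5` then gives `4 * r 0
    -- 2 = 0`.
    have e0 := sum_eq ![0, 2, 1, 3, 4, 5] (hinj (by decide)) (by decide)
    have e1 := sum_eq ![1, 3, 2, 4, 5, 0] (hinj (by decide)) (by decide)
    have e2 := sum_eq ![2, 4, 3, 5, 0, 1] (hinj (by decide)) (by decide)
    have e3 := sum_eq ![3, 5, 4, 0, 1, 2] (hinj (by decide)) (by decide)
    have e4 := sum_eq ![4, 0, 5, 1, 2, 3] (hinj (by decide)) (by decide)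
    have e5 := sum_eq ![0, 2, 4, 5, 3, 1] (hinj (by decide)) (by decide)
    have n1 := hneg 1 3 (by decide)
    have n2 := hneg 3 5 (by decide)
    have n3 := hneg 0 4 (by decide)
    have n4 := hneg 1 5 (by decide)
    simp only [Matrix.cons_val, h01, h12, h34, h45, h50, h05, h10, h21, h32, h54, h43, h23]
      at e0 e1 e2 e3 e4 e5
    have h02 : r 0 2 = 0 := by
      have : 2 * (2 * r 0 2) = 0 := by
        linear_combination e5 + 3 * e0 - 2 * e1 + e2 - n1 - n2
      simpa [h2] using this
    have h13 : r 1 3 = 0 := by linear_combination e0 - h02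
    have h24 : r 2 4 = 0 := by linear_combination e1 - h13
    have h35 : r 3 5 = 0 := by linear_combination e2 - h24
    have h04 : r 0 4 = 0 := by linear_combination -e3 + n3 + h35
    have h15 : r 1 5 = 0 := by linear_combination -e4 + n3 + n4 - h04
    apply key
    intro s t hst hadj
    fin_cases s <;> fin_cases t <;> 
      first | assumption | exact absurd hst (by decide) | exact absurd hadj (by decide)
  · left
    have e0 := sum_eq ![0, 2, 1, 3, 4, 5] (hinj (by decide)) (by decide)
    have e1 := sum_eq ![1, 3, 2, 4, 5, 0] (hinj (by decide)) (by decide)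
    have e2 := sum_eq ![2, 4, 3, 5, 0, 1] (hinj (by decide)) (by decide)
    have e3 := sum_eq ![3, 5, 4, 0, 1, 2] (hinj (by decide)) (by decide)
    have e4 := sum_eq ![4, 0, 5, 1, 2, 3] (hinj (by decide)) (by decide)
    have e5 := sum_eq ![0, 2, 4, 5, 3, 1] (hinj (by decide)) (by decide)
    -- The other chords vanish as for the octahedron; each of `e6`, `e7`, `e8` contains exactly one
    -- of the long diagonals.
    have e6 := sum_eq ![0, 3, 2, 1, 5, 4] (hinj (by decide)) (by decide)
    have e7 := sum_eq ![1, 4, 3, 2, 0, 5] (hinj (by decide)) (by decide)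
    have e8 := sum_eq ![2, 5, 4, 3, 1, 0] (hinj (by decide)) (by decide)
    have n0 := hneg 0 2 (by decide)
    have n1 := hneg 1 3 (by decide)
    have n2 := hneg 3 5 (by decide)
    have n3 := hneg 0 4 (by decide)
    have n4 := hneg 1 5 (by decide)
    simp only [Matrix.cons_val, h01, h12, h34, h45, h50, h05, h10, h21, h32, h54, h43, h23]
      at e0 e1 e2 e3 e4 e5 e6 e7 e8
    have h02 : r 0 2 = 0 := by
      have : 2 * (2 * r 0 2) = 0 := by
        linear_combination e5 + 3 * e0 - 2 * e1 + e2 - n1 - n2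
      simpa [h2] using this
    have h13 : r 1 3 = 0 := by linear_combination e0 - h02
    have h24 : r 2 4 = 0 := by linear_combination e1 - h13
    have h35 : r 3 5 = 0 := by linear_combination e2 - h24
    have h04 : r 0 4 = 0 := by linear_combination -e3 + n3 + h35
    have h15 : r 1 5 = 0 := by linear_combination -e4 + n3 + n4 - h04
    have h03 : r 0 3 = 0 := by linear_combination e6 - n3 + h04 - h15
    have h14 : r 1 4 = 0 := by linear_combination e7 - n0 + h02 - n4 + h15
    have h25 : r 2 5 = 0 := by linear_combination e8 - n1 + h13 - h02
    apply key
    intro s t hst hadj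
    fin_cases s <;> fin_cases t <;> 
      first | assumption | exact absurd hst (by decide)

variable {V ι : Type*} {X : SimpleGraph V} {p : ℕ}

theorem Connected.blockGraph {b : V → ι} (h : X.Connected) (hb : Function.Surjective b) :
    (X.blockGraph b).Connected := by
  have := h.nonempty.map b
  refine ⟨fun i j => ?_⟩
  obtain ⟨u, rfl⟩ := hb i
  obtain ⟨v, rfl⟩ := hb j
  obtain ⟨w⟩ := h.preconnected u v
  induction w with
  | nil => rfl
  | @cons x y z hadj _ ih =>
    by_cases hxy : b x = b y
    · rwa [hxy]
    · exact (Adj.reachable (G := X.blockGraph b) ⟨hxy, x, y, rfl, rfl, hadj⟩).trans ih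

namespace IsCyclicSystem

variable {b : V → ι} {f : ι → ZMod p → V} [Fintype V] [DecidableEq V] [Fintype ι] [Fact p.Prime]

/-- A connected regular system without edges inside the blocks has a Hamilton cycle. -/
theorem hamiltonian_of_no_inner (h : X.IsCyclicSystem b f) (hp : 3 < p)
    (hι : Fintype.card ι = 6) [DecidableRel (X.blockGraph b).Adj] {d : ℕ}
    (hreg : ∀ i, (X.blockGraph b).degree i = d) (hconn : X.Connected)
    (hinner : ∀ u v, X.Adj u v → b u ≠ b v) :
    ∃ (v : V) (C : X.Walk v v), C.IsHamiltonianCycle := by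
  by_contra hno
  have hb : Function.Surjective b := fun i => ⟨f i 0, h.block i 0⟩
  have hYconn := hconn.blockGraph hb
  have hzero (c : Fin 6 → ι) (hc : Function.Injective c) (w : Fin 6 → ZMod p)
      (hw : ∀ t, X.Adj (f (c t) 0) (f (c (t + 1)) (w t))) : ∑ t, w t = 0 := by
    by_contra hne
    refine hno (h.hamiltonian_of_voltage ?_ w hw hne)
    exact (Fintype.bijective_iff_injective_and_card c).mpr ⟨hc, by simp [hι]⟩
  -- Changing the voltage of the closing edge alone must keep the total zero, so this voltage is
  -- unique. Every edge of the quotient closes some Hamilton cycle.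
  have huniq₀ (c : Fin 6 → ι) (hc : Function.Injective c)
      (hadj : ∀ t, (X.blockGraph b).Adj (c t) (c (t + 1))) (z z' : ZMod p)
      (hz : X.Adj (f (c 5) 0) (f (c 0) z)) (hz' : X.Adj (f (c 5) 0) (f (c 0) z')) : z = z' := by
    choose w hw using fun t => h.exists_voltage (hadj t)
    have aux (z : ZMod p) (hz : X.Adj (f (c 5) 0) (f (c 0) z)) :
        w 0 + w 1 + w 2 + w 3 + w 4 + z = 0 := by
      have := hzero c hc (Function.update w 5 z) (fun t => by
        by_cases ht : t = 5
        · subst ht; simpa using hz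
        · rw [Function.update_of_ne ht]; exact hw t)
      simpa [Fin.sum_univ_six, Function.update] using this
    exact add_left_cancel ((aux z hz).trans (aux z' hz').symm)
  have huniq {i j : ι} (hij : (X.blockGraph b).Adj i j) {z z' : ZMod p}
      (hz : X.Adj (f i 0) (f j z)) (hz' : X.Adj (f i 0) (f j z')) : z = z' := by
    obtain ⟨c, hc, hadj, ⟨rfl, rfl⟩ | ⟨rfl, rfl⟩⟩ :=
      exists_hamiltonian_six_cycle hι _ hreg hYconn hij
    · exact huniq₀ c hc hadj z z' hz hz'
    · exact neg_injective (huniq₀ c hc hadj _ _ (h.adj_neg hz) (h.adj_neg hz'))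
  have hex (i j : ι) : ∃ w, (X.blockGraph b).Adj i j → X.Adj (f i 0) (f j w) := by
    by_cases hij : (X.blockGraph b).Adj i j
    · obtain ⟨w, hw⟩ := h.exists_voltage hij
      exact ⟨w, fun _ => hw⟩
    · exact ⟨0, fun h => absurd h hij⟩
  choose W hW using hex
  have hWneg {i j : ι} (hij : (X.blockGraph b).Adj i j) : W j i = -W i j :=
    huniq hij.symm (hW j i hij.symm) (h.adj_neg (hW i j hij))
  obtain ⟨k, e, hk, he⟩ := exists_equiv_sixGraph_of_connected hι _ hreg hYconn
  have hcyc : ∀ t, sixGraph k t (t + 1) = true :=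
    (by decide : ∀ k : Fin 8, k < 5 → ∀ t, sixGraph k t (t + 1) = true) k hk
  -- Subtracting the potential `g` makes the voltages vanish along the cycle `0, 1, …, 5`: on five
  -- edges by construction, on the last because the total is zero.
  let g : Fin 6 → ZMod p := partialSums fun t => W (e t) (e (t + 1))
  let r : Fin 6 → Fin 6 → ZMod p := fun s t => W (e s) (e t) - g t + g s
  have hr (c : Fin 6 → Fin 6) (hc : Function.Injective c)
      (hadj : ∀ t, sixGraph k (c t) (c (t + 1)) = true) : ∑ t, r (c t) (c (t + 1)) = 0 := by
    have h1 := hzero (fun t => e (c t)) (e.injective.comp hc)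
      (fun t => W (e (c t)) (e (c (t + 1)))) (fun t => hW _ _ ((he _ _).mpr (hadj t)))
    have h2 : ∑ t, g (c (t + 1)) = ∑ t, g (c t) :=
      Equiv.sum_comp (Equiv.addRight (1 : Fin 6)) fun t => g (c t)
    simp only [r, Finset.sum_add_distrib, Finset.sum_sub_distrib, h1, h2]
    ring
  have hrcyc (t : Fin 6) : r t (t + 1) = 0 := by
    have h5 := hr id Function.injective_id hcyc
    have hlt (t : Fin 5) : r t.castSucc (t.castSucc + 1) = 0 := by
      fin_cases t <;> simp [r, g, partialSums] <;> ring
    have h0 : r 0 1 = 0 := hlt 0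
    have h1 : r 1 2 = 0 := hlt 1
    have h2 : r 2 3 = 0 := hlt 2
    have h3 : r 3 4 = 0 := hlt 3
    have h4 : r 4 5 = 0 := hlt 4
    rw [Fin.sum_univ_six] at h5
    replace h5 : r 0 1 + r 1 2 + r 2 3 + r 3 4 + r 4 5 + r 5 0 = 0 := h5
    rw [h0, h1, h2, h3, h4] at h5
    induction t using Fin.lastCases with
    | cast t => exact hlt t
    | last =>
      have : r 5 0 = 0 := by simpa using h5
      exact this
  have hrneg (s t : Fin 6) (hst : sixGraph k s t = true) : r t s = -r s t := by
    simp only [r, hWneg ((he s t).mpr hst)]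
    ring
  have hne {n : ℕ} (hn : 0 < n) (hn' : n < p) : (n : ZMod p) ≠ 0 := fun h0 => by
    rw [ZMod.natCast_eq_zero_iff] at h0
    exact absurd (Nat.le_of_dvd hn h0) (by omega)
  have hadj_iff {s t : Fin 6} (hst : sixGraph k s t = true) (x y : ZMod p) :
      X.Adj (f (e s) x) (f (e t) y) ↔ y - g t = x - g s + r s t := by
    have hij := (he s t).mpr hst
    rw [h.adj_iff]
    constructor
    · intro hadj
      have := huniq hij hadj (hW _ _ hij)
      simp only [r, ← this]; ring
    · intro heq
      have : y - x = W (e s) (e t) := by simp only [r] at heq; linear_combination heq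
      rw [this]
      exact hW _ _ hij
  rcases voltage_eq_zero_or_prism (hne (n := 2) (by omega) (by omega))
    (hne (n := 3) (by omega) hp) hk r hrneg hrcyc hr with hall | ⟨rfl, h02, h35⟩
  -- Index minus potential is now constant along edges, hence on all of `X`, yet it varies within a
  -- single block.
  · choose col hcol using h.cover
    have hconst := hconn.preconnected.eq_of_forall_adj (fun v => col v - g (e.symm (b v)))
      (fun u v huv => by
        have hij : (X.blockGraph b).Adj (b u) (b v) := ⟨hinner u v huv, u, v, rfl, rfl, huv⟩
        have hst : sixGraph k (e.symm (b u)) (e.symm (b v)) = true := by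
          rw [← he]; simpa using hij
        have hadj : X.Adj (f (e (e.symm (b u))) (col u)) (f (e (e.symm (b v))) (col v)) := by
          simpa [hcol] using huv
        rw [hadj_iff hst, hall _ _ hst, add_zero] at hadj
        exact hadj.symm)
    have hcolf (x : ZMod p) : col (f (e 0) x) = x := by
      apply h.injective (e 0)
      have := hcol (f (e 0) x)
      rwa [h.block] at this
    have := hconst (f (e 0) 0) (f (e 0) 1)
    simp only [h.block, hcolf] at this
    exact zero_ne_one (sub_left_injective this)
  · have hrow : X.IsRowSystem fun t x => f (e t) (x + g t) := by
      refine h.isRowSystem e.bijective g fun t => ?_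
      rw [hadj_iff (by rw [← Fin.coeSucc_eq_succ]; exact hcyc _), ← Fin.coeSucc_eq_succ, hrcyc]
      ring
    refine hno (hrow.hamiltonian_of_prism (c := -r 0 2) (neg_ne_zero.mpr h02) ?_ ?_ ?_)
    · intro x
      rw [hadj_iff (by decide), hrneg 0 2 (by decide)]
      ring
    · intro x
      rw [hadj_iff (by decide), hrneg 3 5 (by decide), h35]
      ring
    · intro x
      have : r 5 0 = 0 := hrcyc 5
      rw [hadj_iff (by decide), this]
      ring

end IsCyclicSystem

end SimpleGraph

/-! ### Matchings between blocks and elements of order `p` -/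

namespace SimpleGraph

variable {V ι : Type*} {X : SimpleGraph V} {p : ℕ}

/-- Equitable blocks of the same size that are joined by an edge are perfectly matched. -/
theorem exists_block_matching [Fintype V] [DecidableEq V] [DecidableEq ι] [DecidableRel X.Adj]
    {b : V → ι} (hp : 0 < p) (hcard : ∀ i, (Finset.univ.filter fun v => b v = i).card = p)
    (hdeg : ∀ u v j, b u = b v → (Finset.univ.filter fun w => b w = j ∧ X.Adj u w).card =
      (Finset.univ.filter fun w => b w = j ∧ X.Adj v w).card)
    {i j : ι} (hij : (X.blockGraph b).Adj i j) (ρ : ZMod p → V) (hρ : Function.Injective ρ)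
    (hb : ∀ x, b (ρ x) = i) :
    ∃ ρ' : ZMod p → V, Function.Injective ρ' ∧ (∀ x, b (ρ' x) = j) ∧ ∀ x, X.Adj (ρ x) (ρ' x) := by
  -- Double counting of the edges between `S` and its neighbours in the other block; `hdeg` makes
  -- the degrees constant on each block. For blocks of equal size the two degrees agree, and
  -- cancelling them gives Hall's condition.
  have count {u v : V} (S : Finset V) (hS : ∀ w ∈ S, b w = b u) :
      S.card * (Finset.univ.filter fun w => b w = b v ∧ X.Adj u w).card ≤
        (S.biUnion fun s => Finset.univ.filter fun w => b w = b v ∧ X.Adj s w).card *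
          (Finset.univ.filter fun w => b w = b u ∧ X.Adj v w).card := by
    refine Finset.card_mul_le_card_mul X.Adj (fun s hs => ?_) (fun w hw => ?_)
    · rw [hdeg u s _ (hS s hs).symm]
      refine Finset.card_le_card fun w hw => ?_
      rw [Finset.mem_bipartiteAbove, Finset.mem_biUnion]
      exact ⟨⟨s, hs, hw⟩, (Finset.mem_filter.mp hw).2.2⟩
    · obtain ⟨s, -, hw⟩ := Finset.mem_biUnion.mp hw
      rw [hdeg v w _ (Finset.mem_filter.mp hw).2.1.symm]
      refine Finset.card_le_card fun s hs => ?_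
      rw [Finset.mem_bipartiteBelow] at hs
      exact Finset.mem_filter.mpr ⟨Finset.mem_univ _, hS s hs.1, hs.2.symm⟩
  have count_all (u v : V) :
      (Finset.univ.filter fun w => b w = b v ∧ X.Adj u w).card ≤
        (Finset.univ.filter fun w => b w = b u ∧ X.Adj v w).card := by
    have h1 := count (u := u) (v := v) (Finset.univ.filter fun w => b w = b u)
      (fun w hw => (Finset.mem_filter.mp hw).2)
    rw [hcard] at h1
    refine Nat.le_of_mul_le_mul_left (h1.trans (Nat.mul_le_mul_right _ ?_)) hp
    rw [← hcard (b v)]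
    refine Finset.card_le_card fun w hw => ?_
    obtain ⟨s, -, hw⟩ := Finset.mem_biUnion.mp hw
    exact Finset.mem_filter.mpr ⟨Finset.mem_univ _, (Finset.mem_filter.mp hw).2.1⟩
  obtain ⟨-, u, v, rfl, rfl, huv⟩ := hij
  have hpos : 0 < (Finset.univ.filter fun w => b w = b v ∧ X.Adj u w).card :=
    Finset.card_pos.mpr ⟨v, by simpa using huv⟩
  obtain ⟨ρ', hρ', hmem⟩ := (Finset.all_card_le_biUnion_card_iff_exists_injective
    fun x => Finset.univ.filter fun w => b w = b v ∧ X.Adj (ρ x) w).mp (fun s => by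
      have h1 := count (u := u) (v := v) (s.image ρ) (fun w hw => by
        obtain ⟨x, -, rfl⟩ := Finset.mem_image.mp hw
        exact hb x)
      rw [Finset.card_image_of_injective _ hρ, Finset.image_biUnion,
        ← le_antisymm (count_all u v) (count_all v u)] at h1
      exact Nat.le_of_mul_le_mul_right h1 hpos)
  simp only [Finset.mem_filter, Finset.mem_univ, true_and] at hmem
  exact ⟨ρ', hρ', fun x => (hmem x).1, fun x => (hmem x).2⟩

/-- A Hamilton cycle of blocks with a complete bipartite edge lifts to a Hamilton cycle. -/
theorem hamiltonian_of_complete_blocks [Fintype V] [DecidableEq V] [DecidableEq ι]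
    [DecidableRel X.Adj] [Fact p.Prime] {b : V → ι}
    (hcard : ∀ i, (Finset.univ.filter fun v => b v = i).card = p)
    (hdeg : ∀ u v j, b u = b v → (Finset.univ.filter fun w => b w = j ∧ X.Adj u w).card =
      (Finset.univ.filter fun w => b w = j ∧ X.Adj v w).card)
    {c : Fin 6 → ι} (hc : Function.Bijective c)
    (hadj : ∀ t, (X.blockGraph b).Adj (c t) (c (t + 1)))
    (hcomplete : ∀ u v, b u = c 5 → b v = c 0 → X.Adj u v) :
    ∃ (v : V) (C : X.Walk v v), C.IsHamiltonianCycle := by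
  have hp : 0 < p := (Fact.out : p.Prime).pos
  have match' (t : Fin 6) := exists_block_matching hp hcard hdeg (hadj t)
  obtain ⟨ρ₀, h0, hb0⟩ : ∃ ρ₀ : ZMod p → V, Function.Injective ρ₀ ∧ ∀ x, b (ρ₀ x) = c 0 := by
    have hc0 := hcard (c 0)
    rw [← Fintype.card_subtype] at hc0
    obtain ⟨e⟩ := Fintype.card_eq.mp ((ZMod.card p).trans hc0.symm)
    exact ⟨fun x => (e x : V), Subtype.val_injective.comp e.injective, fun x => (e x).2⟩
  obtain ⟨ρ₁, h1, hb1, ha1⟩ := match' 0 ρ₀ h0 hb0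
  obtain ⟨ρ₂, h2, hb2, ha2⟩ := match' 1 ρ₁ h1 hb1
  obtain ⟨ρ₃, h3, hb3, ha3⟩ := match' 2 ρ₂ h2 hb2
  obtain ⟨ρ₄, h4, hb4, ha4⟩ := match' 3 ρ₃ h3 hb3
  obtain ⟨ρ₅, h5, hb5, ha5⟩ := match' 4 ρ₄ h4 hb4
  have hb (t : Fin 6) : ∀ x, b (![ρ₀, ρ₁, ρ₂, ρ₃, ρ₄, ρ₅] t x) = c t := by
    fin_cases t
    exacts [hb0, hb1, hb2, hb3, hb4, hb5]
  have hinj (t : Fin 6) : Function.Injective (![ρ₀, ρ₁, ρ₂, ρ₃, ρ₄, ρ₅] t) := by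
    fin_cases t
    exacts [h0, h1, h2, h3, h4, h5]
  have hrow : X.IsRowSystem ![ρ₀, ρ₁, ρ₂, ρ₃, ρ₄, ρ₅] := by
    refine ⟨fun s t x y hxy => ?_, fun v => ?_, fun t => ?_⟩
    · have := congrArg b hxy
      rw [hb, hb] at this
      obtain rfl := hc.1 this
      exact ⟨rfl, hinj _ hxy⟩
    · obtain ⟨t, ht⟩ := hc.2 (b v)
      have himg : Finset.univ.image (![ρ₀, ρ₁, ρ₂, ρ₃, ρ₄, ρ₅] t) =
          Finset.univ.filter fun w => b w = c t := by
        refine Finset.eq_of_subset_of_card_le (fun w hw => ?_) ?_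
        · obtain ⟨x, -, rfl⟩ := Finset.mem_image.mp hw
          exact Finset.mem_filter.mpr ⟨Finset.mem_univ _, hb t x⟩
        · rw [hcard, Finset.card_image_of_injective _ (hinj t), Finset.card_univ, ZMod.card]
      have hv : v ∈ Finset.univ.filter fun w => b w = c t := by simp [ht]
      rw [← himg] at hv
      obtain ⟨x, -, hx⟩ := Finset.mem_image.mp hv
      exact ⟨t, x, hx⟩
    · fin_cases t
      exacts [ha1, ha2, ha3, ha4, ha5]
  -- Any nonzero shift would do; shift `0` would close each column separately.
  exact hrow.hamiltonian_of_shift one_ne_zero fun x => hcomplete _ _ (hb5 _) (hb0 _)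

section action

variable {G : Type*} [Group G] [MulAction G V] {b : V → ι} {α : G}

/-- A moved vertex of a block of size `p` generates the block under an element of order `p`. -/
theorem exists_pow_smul_eq [Fintype V] [DecidableEq ι] [Fact p.Prime]
    (hcard : ∀ i, (Finset.univ.filter fun v => b v = i).card = p) (hα : α ^ p = 1)
    (hblock : ∀ v, b (α • v) = b v) {u : V} (hu : α • u ≠ u) :
    (∀ v, b v = b u → ∃ k < p, α ^ k • u = v) ∧
      ∀ k < p, ∀ l < p, α ^ k • u = α ^ l • u → k = l := by
  classical
  have hper : Function.minimalPeriod (fun v : V => α • v) u = p := by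
    have hiter (k : ℕ) : (fun v : V => α • v)^[k] u = α ^ k • u := smul_iterate_apply α k u
    have hdvd : Function.minimalPeriod (fun v : V => α • v) u ∣ p :=
      Function.IsPeriodicPt.minimalPeriod_dvd (by
        rw [Function.IsPeriodicPt, Function.IsFixedPt, hiter, hα, one_smul])
    refine ((Nat.dvd_prime Fact.out).mp hdvd).resolve_left fun h1 => hu ?_
    exact Function.minimalPeriod_eq_one_iff_isFixedPt.mp h1
  have hinj : ∀ k < p, ∀ l < p, α ^ k • u = α ^ l • u → k = l := by
    intro k hk l hl hkl
    rw [← smul_iterate_apply, ← smul_iterate_apply] at hkl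
    exact Function.iterate_injOn_Iio_minimalPeriod (by simpa [hper] using hk)
      (by simpa [hper] using hl) hkl
  refine ⟨fun v hv => ?_, hinj⟩
  have hpow (k : ℕ) : b (α ^ k • u) = b u := by
    induction k with
    | zero => simp
    | succ k ih => rw [pow_succ', mul_smul, hblock, ih]
  have himg : (Finset.range p).image (fun k => α ^ k • u) =
      Finset.univ.filter fun w => b w = b u := by
    refine Finset.eq_of_subset_of_card_le (fun w hw => ?_) ?_
    · obtain ⟨k, -, rfl⟩ := Finset.mem_image.mp hw
      exact Finset.mem_filter.mpr ⟨Finset.mem_univ _, hpow k⟩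
    · rw [hcard, Finset.card_image_of_injOn, Finset.card_range]
      intro k hk l hl
      exact hinj k (by simpa using hk) l (by simpa using hl)
  have hv' : v ∈ Finset.univ.filter fun w => b w = b u := by simp [hv]
  rw [← himg] at hv'
  obtain ⟨k, hk, hx⟩ := Finset.mem_image.mp hv'
  exact ⟨k, Finset.mem_range.mp hk, hx⟩

/-- An automorphism of order `p` without fixed vertices gives cyclic coordinates. -/
theorem exists_isCyclicSystem [Fintype V] [DecidableEq ι] [Fact p.Prime]
    (hcard : ∀ i, (Finset.univ.filter fun v => b v = i).card = p) (hα : orderOf α = p)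
    (hblock : ∀ v, b (α • v) = b v) (hfree : ∀ v : V, α • v ≠ v)
    (hadj : ∀ u v, X.Adj u v → X.Adj (α • u) (α • v)) :
    ∃ f : ι → ZMod p → V, X.IsCyclicSystem b f := by
  have hα' : α ^ p = 1 := hα ▸ pow_orderOf_eq_one α
  have hrep (i : ι) : ∃ v, b v = i := by
    have : (Finset.univ.filter fun v => b v = i).Nonempty :=
      Finset.card_pos.mp (by rw [hcard]; exact (Fact.out : p.Prime).pos)
    obtain ⟨v, hv⟩ := this
    exact ⟨v, (Finset.mem_filter.mp hv).2⟩
  choose rep hrep using hrep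
  have hpow (k : ℕ) (v : V) : b (α ^ k • v) = b v := by
    induction k with
    | zero => simp
    | succ k ih => rw [pow_succ', mul_smul, hblock, ih]
  have hadj' (k : ℕ) {u v : V} (huv : X.Adj u v) : X.Adj (α ^ k • u) (α ^ k • v) := by
    induction k with
    | zero => simpa using huv
    | succ k ih => rw [pow_succ', mul_smul, mul_smul]; exact hadj _ _ ih
  have hgen (i : ι) := exists_pow_smul_eq hcard hα' hblock (hfree (rep i))
  refine ⟨fun i x => α ^ x.val • rep i, fun i x => ?_, fun i x y hxy => ?_, fun v => ?_,
    fun i j x y z hxy => ?_⟩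
  · rw [hpow, hrep]
  · exact ZMod.val_injective p ((hgen i).2 _ x.val_lt _ y.val_lt hxy)
  · obtain ⟨k, hk, hv⟩ := (hgen (b v)).1 v (hrep _).symm
    exact ⟨k, by rw [ZMod.val_cast_of_lt hk, hv]⟩
  · have hval (x : ZMod p) (v : V) : α ^ (x + z).val • v = α ^ z.val • α ^ x.val • v := by
      have hmod (k : ℕ) : α ^ (k % p) = α ^ k := by
        have := pow_mod_orderOf α k
        rwa [hα] at this
      rw [ZMod.val_add, ← mul_smul, ← pow_add, add_comm x.val, hmod]
    rw [hval, hval]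
    exact hadj' _ hxy

end action

end SimpleGraph

/-! ### The case distinction on fixed vertices -/

namespace SimpleGraph

variable {V ι : Type*} {X : SimpleGraph V} {p : ℕ}

/-- A connected graph with six blocks of prime size `p > 3` has a Hamilton cycle if the
blocks are permuted by a transitive group `G` of automorphisms and are the orbits of a normal
subgroup `N` of `G`. -/
theorem hamiltonian_of_six_blocks {G : Type*} [Group G] [MulAction G V] [FaithfulSMul G V]
    [Finite G] [Fintype V] [DecidableEq V] [Fintype ι] [DecidableEq ι] [hp : Fact p.Prime]
    [MulAction.IsPretransitive G V] (hp3 : 3 < p) (hι : Fintype.card ι = 6)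
    (hconn : X.Connected) (hadj : ∀ (g : G) u v, X.Adj u v → X.Adj (g • u) (g • v))
    {b : V → ι} (hb : Function.Surjective b)
    (hcard : ∀ i, (Finset.univ.filter fun v => b v = i).card = p)
    {N : Subgroup G} (hN : ∀ u v, b u = b v ↔ ∃ n ∈ N, n • u = v)
    (hG : ∀ (g : G) u v, b u = b v → b (g • u) = b (g • v)) :
    ∃ (v : V) (C : X.Walk v v), C.IsHamiltonianCycle := by
  classical
  have hadj_iff (g : G) (u v : V) : X.Adj (g • u) (g • v) ↔ X.Adj u v :=
    ⟨fun h => by simpa using hadj g⁻¹ _ _ h, hadj g u v⟩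
  have hNb {n : G} (hn : n ∈ N) (v : V) : b (n • v) = b v := ((hN v (n • v)).mpr ⟨n, hn, rfl⟩).symm
  have hYconn := hconn.blockGraph hb
  obtain ⟨d, hreg⟩ : ∃ d, ∀ i, (X.blockGraph b).degree i = d := by
    obtain ⟨v₀⟩ := hconn.nonempty
    refine ⟨(X.blockGraph b).degree (b v₀), fun i => ?_⟩
    obtain ⟨v, rfl⟩ := hb i
    have hle (u v : V) : (X.blockGraph b).degree (b u) ≤ (X.blockGraph b).degree (b v) := by
      obtain ⟨g, rfl⟩ := MulAction.exists_smul_eq G u v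
      choose rep hrep using hb
      rw [← card_neighborFinset_eq_degree, ← card_neighborFinset_eq_degree]
      refine Finset.card_le_card_of_injOn (fun j => b (g • rep j)) (fun j hj => ?_) ?_
      · simp only [Finset.mem_coe, mem_neighborFinset] at hj ⊢
        obtain ⟨hne, x, y, hx, rfl, hxy⟩ := hj
        refine ⟨fun heq => hne ?_, g • x, g • y, hG g _ _ hx, hG g _ _ (hrep _).symm,
          hadj g _ _ hxy⟩
        have := hG g⁻¹ _ _ heq
        simpa [hrep] using this
      · intro j _ j' _ hjj
        have := hG g⁻¹ _ _ hjj
        simpa [hrep] using this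
    exact le_antisymm (hle _ _) (hle _ _)
  have hdeg (u v : V) (j : ι) (huv : b u = b v) :
      (Finset.univ.filter fun w => b w = j ∧ X.Adj u w).card =
        (Finset.univ.filter fun w => b w = j ∧ X.Adj v w).card := by
    obtain ⟨n, hn, rfl⟩ := (hN u v).mp huv
    refine Finset.card_bij (fun w _ => n • w) (fun w hw => ?_)
      (fun _ _ _ _ h => MulAction.injective n h) (fun w hw => ⟨n⁻¹ • w, ?_, by simp⟩)
    · simp only [Finset.mem_filter, Finset.mem_univ, true_and] at hw ⊢
      exact ⟨by rw [hNb hn, hw.1], hadj n _ _ hw.2⟩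
    · simp only [Finset.mem_filter, Finset.mem_univ, true_and] at hw ⊢
      exact ⟨by rw [hNb (N.inv_mem hn), hw.1], by rw [← hadj_iff n]; simpa using hw.2⟩
  have hbij {c : Fin 6 → ι} (hc : Function.Injective c) : Function.Bijective c :=
    (Fintype.bijective_iff_injective_and_card c).mpr ⟨hc, by simp [hι]⟩
  obtain ⟨α, hα, hαord⟩ : ∃ α ∈ N, orderOf α = p := by
    obtain ⟨v₀⟩ := hconn.nonempty
    have horb : Nat.card (MulAction.orbit N v₀) = p := by
      rw [Nat.card_coe_set_eq, ← hcard (b v₀), ← Set.ncard_coe_finset]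
      congr 1
      ext v
      simp only [MulAction.mem_orbit_iff, Finset.coe_filter, Finset.mem_univ, true_and,
        Set.mem_ofPred_eq]
      rw [eq_comm, hN]
      exact ⟨fun ⟨n, hn⟩ => ⟨n, n.2, hn⟩, fun ⟨n, hn, h⟩ => ⟨⟨n, hn⟩, h⟩⟩
    have hdvd : p ∣ Nat.card N := by
      rw [← horb, Nat.card_coe_set_eq, ← MulAction.index_stabilizer]
      exact Subgroup.index_dvd_card _
    obtain ⟨α, hα⟩ := exists_prime_orderOf_dvd_card' p hdvd
    exact ⟨α, α.2, by rw [← hα, Subgroup.orderOf_coe]⟩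
  have hαp : α ^ p = 1 := hαord ▸ pow_orderOf_eq_one α
  have hαb := hNb hα
  by_cases hfree : ∀ v : V, α • v ≠ v
  · obtain ⟨f, hf⟩ := exists_isCyclicSystem hcard hαord hαb hfree (hadj α)
    by_cases hinner : ∀ u v, X.Adj u v → b u ≠ b v
    · exact hf.hamiltonian_of_no_inner hp3 hι hreg hconn hinner
    · push Not at hinner
      obtain ⟨u, v, huv, hbuv⟩ := hinner
      have hstep (i : ι) : ∃ s, X.Adj (f i 0) (f i s) := by
        obtain ⟨g, hg⟩ := MulAction.exists_smul_eq G u (f i 0)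
        obtain ⟨s, hs⟩ := hf.cover (g • v)
        rw [← hG g u v hbuv, hg, hf.block] at hs
        exact ⟨s, by rw [hs, ← hg]; exact hadj g u v huv⟩
      choose s hs using hstep
      obtain ⟨k, e, hk, he⟩ := exists_equiv_sixGraph_of_connected hι _ hreg hYconn
      refine hf.hamiltonian_of_inner hp3 e.bijective (fun t => (he _ _).mpr ?_) s hs
      exact (by decide : ∀ k : Fin 8, k < 5 → ∀ t, sixGraph k t (t + 1) = true) k hk t
  · push Not at hfree
    obtain ⟨v₀, hv₀⟩ := hfree
    have hgen {u : V} (hu : α • u ≠ u) := exists_pow_smul_eq hcard hαp hαb hu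
    -- Otherwise all vertices are fixed along with `v₀`, and `α = 1` by faithfulness.
    obtain ⟨u, v, huv, hu, hv⟩ : ∃ u v, X.Adj u v ∧ α • u ≠ u ∧ α • v = v := by
      by_contra! hcon
      have hall := hconn.preconnected.eq_of_forall_adj (fun v => α • v = v) (fun u v huv => by
        refine propext ⟨fun hu => ?_, fun hv => ?_⟩
        · by_contra hv
          exact hcon v u huv.symm hv hu
        · by_contra hu
          exact hcon u v huv hu hv)
      have h1 : α = 1 := FaithfulSMul.eq_of_smul_eq_smul (α := V) fun v => by
        rw [one_smul, hall v v₀]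
        exact hv₀
      rw [h1, orderOf_one] at hαord
      omega
    have hne : b u ≠ b v := fun heq => by
      obtain ⟨k, -, hk⟩ := (hgen hu).1 v heq.symm
      apply hu
      have : α • α ^ k • u = α ^ k • u := by rw [hk, hv]
      rw [← mul_smul, ← pow_succ', pow_succ, mul_smul] at this
      exact MulAction.injective _ this
    -- The powers of `α` fix `v` and move `u` through its whole block, so `v` is adjacent to that
    -- block; `N` preserves the block of `u` and carries `v` to every vertex of its own.
    have hcomplete (x y : V) (hx : b x = b u) (hy : b y = b v) : X.Adj x y := by
      obtain ⟨n, hn, rfl⟩ := (hN v y).mp hy.symm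
      rw [← hadj_iff n⁻¹, inv_smul_smul]
      obtain ⟨k, -, hk⟩ := (hgen hu).1 (n⁻¹ • x) (by rw [hNb (N.inv_mem hn), hx])
      have hkv : α ^ k • v = v := by
        clear hk
        induction k with
        | zero => simp
        | succ k ih => rw [pow_succ', mul_smul, ih, hv]
      rw [← hk, ← hkv]
      exact hadj _ _ _ huv
    obtain ⟨c, hc, hcadj, hends⟩ := exists_hamiltonian_six_cycle hι _ hreg hYconn
      (i := b u) (j := b v) ⟨hne, u, v, rfl, rfl, huv⟩
    refine hamiltonian_of_complete_blocks hcard hdeg (hbij hc) hcadj fun x y hx hy => ?_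
    rcases hends with ⟨h5, h0⟩ | ⟨h5, h0⟩
    · exact hcomplete x y (hx.trans h5) (hy.trans h0)
    · exact (hcomplete y x (hy.trans h0) (hx.trans h5)).symm

end SimpleGraph

theorem mainTheorem5 {V : Type*} [Fintype V] [DecidableEq V] (X : SimpleGraph V)
    (p : ℕ) (hp : p.Prime) (hp3 : 3 < p) (hcard : Fintype.card V = 6 * p)
    (hconn : X.Connected) (himp : X.IsGenuinelyImprimitiveWithBlockSize p) :
    ∃ (v : V) (C : X.Walk v v), C.IsHamiltonianCycle := by
  classical
  obtain ⟨G, N, ⟨htrans, hnorm, -⟩, hsize⟩ := himp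
  have : Fact p.Prime := ⟨hp⟩
  have : Finite (X ≃g X) := Finite.of_injective (fun g => (g : V → V)) DFunLike.coe_injective
  let b : V → MulAction.orbitRel.Quotient N V := Quotient.mk _
  have hN (u v : V) : b u = b v ↔ ∃ n ∈ N, n • u = v := by
    rw [eq_comm, Quotient.eq, MulAction.orbitRel_apply, MulAction.mem_orbit_iff]
    exact ⟨fun ⟨n, hn⟩ => ⟨n, n.2, hn⟩, fun ⟨n, hn, h⟩ => ⟨⟨n, hn⟩, h⟩⟩
  have hblock (i) : (Finset.univ.filter fun v => b v = i).card = p := by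
    induction i using Quotient.inductionOn with | h v => ?_
    rw [← hsize _ ⟨v, rfl⟩, ← Set.ncard_coe_finset]
    congr 1
    ext u
    simp only [Finset.coe_filter, Finset.mem_univ, true_and, Set.mem_ofPred_eq]
    exact Quotient.eq
  have hι : Fintype.card (MulAction.orbitRel.Quotient N V) = 6 := by
    have h1 := Finset.card_eq_sum_card_fiberwise (f := b) (s := Finset.univ) (t := Finset.univ)
      (fun _ _ => Finset.mem_coe.mpr (Finset.mem_univ _))
    simp only [hblock, Finset.sum_const, smul_eq_mul, Finset.card_univ, hcard] at h1
    exact (Nat.eq_of_mul_eq_mul_right hp.pos h1).symm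
  refine SimpleGraph.hamiltonian_of_six_blocks (G := G) hp3 hι hconn
    (fun g u v huv => (SimpleGraph.Iso.map_adj_iff (g : X ≃g X)).mpr huv) Quotient.mk_surjective
    hblock hN fun g u v huv => ?_
  obtain ⟨n, hn, rfl⟩ := (hN u v).mp huv
  -- Normality of `N` makes `g` map `N`-orbits to `N`-orbits.
  exact (hN _ _).mpr ⟨g * n * g⁻¹, hnorm.conj_mem n hn g, by simp [mul_smul]⟩
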